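/- Let $G$ be the complex Heisenberg group of matrices $\begin{pmatrix}1&z^1&z^3\\0&1&z^2\\0&0&1\end{pmatrix}$, $z\in\mathbb C^3$, let $\Gamma\subset G$ be the subgroup of the matrices with entries in $\mathbb Z[\sqrt{-1}]$, and let $X=\Gamma\backslash G$ be the Iwasawa manifold. Put $\varphi^1=dz^1$, $\varphi^2=dz^2$, $\varphi^3=dz^3-z^1dz^2$, with dual left invariant $(1,0)$-vector fields $\theta^1,\theta^2,\theta^3$. For $\varepsilon>0$ let $$\mathcal B=\mathcal B_\varepsilon=\{t=(t_{11},t_{12},t_{21},t_{22},t_{31},t_{32})\in\mathbb C^6:\ |t_{i\lambda}|<\varepsilon\},\qquad D(t)=t_{11}t_{22}-t_{21}t_{12};$$ for small $\varepsilon$ the Kuranishi family of $X$ is given over $\mathcal B_\varepsilon$ by the Beltrami differentials $\phi(t)=\sum_{i=1}^3\sum_{\lambda=1}^2t_{i\lambda}\,\theta^i\bar\varphi^\lambda-D(t)\,\theta^3\bar\varphi^3$. Let $\wedge^{p,q}\subset A^{p,q}(X)$ be the space of left invariant $(p,q)$-forms and let $\bar\partial_{\phi(t)}=\bar\partial-(i_{\phi(t)}\partial-\partial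 i_{\phi(t)})$, where $i_{\phi(t)}$ is contraction with $\phi(t)$. For a finite set $S\subset\mathbb Z^2$ let $C(S)$ be the bigraded vector space with component $\mathbb C$ in the bidegrees in $S$ and $0$ elsewhere, with maps $\partial_1=(-1)^q$ from $(p,q)$ to $(p+1,q)$ and $\partial_2=1$ from $(p,q)$ to $(p,q+1)$ whenever source and target both lie in $S$. A square is a set $\square(p,q)=\{(p,q),(p+1,q),(p,q+1),(p+1,q+1)\}$. A zigzag is a finite nonempty connected piece of an infinite staircase $\cdots\leftarrow(p,q)\to(p+1,q)\leftarrow(p+1,q-1)\to\cdots$. In particular the following are zigzags: $\bullet(p,q)=\{(p,q)\}$, $h(p,q)=\{(p,q),(p+1,q)\}$, $v(p,q)=\{(p,q),(p,q+1)\}$, $f(p,q)=\{(p,q+1),(p,q),(p+1,q)\}$ (common source $(p,q)$) and $j(p,q)=\{(p-1,q),(p,q),(p,q-1)\}$ (common target $(p,q)$). **Theorem.** For every $\varepsilon>0$ and every $t\in\mathcal B_\varepsilon$, $(\wedge^{\bullet,\bullet},\partial,\bar\partial_{\phi(t)})$ is a double complex (that is, $(\partial+\bar\partial_{\phi(t)})^2=0$).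 It is isomorphic, as a double complex, to the direct sum of the complexes $C(S)$ of squares and zigzags listed in * (i) if and only if $(t_{11},t_{12},t_{21},t_{22})=0$; * (ii) if and only if $(t_{11},t_{12},t_{21},t_{22})\neq0$ and $D(t)=0$; * (iii) if and only if $D(t)\neq0$. All three lists contain the following shapes, where $m\cdot S$ means $m$ copies of $S$: $\square(1,1)$; $v(0,1),\ 2\cdot v(1,1),\ 2\cdot v(2,1),\ v(3,1)$; and the dots $\bullet(0,0)$, $2\cdot\bullet(1,0)$, $\bullet(3,0)$, $2\cdot\bullet(0,1)$, $3\cdot\bullet(1,1)$, $4\cdot\bullet(2,1)$, $2\cdot\bullet(3,1)$, $2\cdot\bullet(0,2)$, $4\cdot\bullet(1,2)$, $3\cdot\bullet(2,2)$, $2\cdot\bullet(3,2)$, $\bullet(0,3)$, $2\cdot\bullet(2,3)$, $\bullet(3,3)$. In addition they contain * (i) $h(1,0),\ 2\cdot h(1,1),\ 2\cdot h(1,2),\ h(1,3),\ 2\cdot\bullet(2,0),\ \bullet(1,1),\ \bullet(2,2),\ 2\cdot\bullet(1,3)$; * (ii) $f(1,0),\ j(2,1),\ h(1,1),\ h(1,2),\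 f(1,2),\ j(2,3),\ \bullet(2,0),\ \bullet(1,3)$; * (iii) $f(1,0),\ 2\cdot j(2,1),\ 2\cdot f(1,2),\ j(2,3)$. Moreover, the family $\{(\wedge^{\bullet,\bullet},\partial,\bar\partial_{\phi(t)})\}_{t\in\mathcal B_\varepsilon}$ has exactly three isomorphism types of double complexes. -/

import Mathlib

noncomputable section

open scoped ContDiff ComplexConjugate

namespace Iwasawa

/-! ### The Heisenberg group and the lattice -/

/-- The underlying complex manifold `ℂ³` of the Heisenberg group `G`, with coordinates
`(z¹, z², z³) = (z 0, z 1, z 2)`. -/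
abbrev E : Type := Fin 3 → ℂ

/-- The matrix of the element of `G` with coordinates `z`. -/
def heisMatrix (z : E) : Matrix (Fin 3) (Fin 3) ℂ := !![1, z 0, z 2; 0, 1, z 1; 0, 0, 1]

/-- The group law of `G` in coordinates, see `heisMatrix_mul`. -/
def mul (g z : E) : E := ![g 0 + z 0, g 1 + z 1, g 2 + z 2 + g 0 * z 1]

theorem heisMatrix_mul (g z : E) : heisMatrix (mul g z) = heisMatrix g * heisMatrix z := by
  ext i j
  fin_cases i <;> fin_cases j <;>
    simp [heisMatrix, mul, Matrix.mul_apply, Fin.sum_univ_three] <;> ring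

/-- The lattice `Γ ⊂ G` of the matrices with entries in `ℤ[√-1]`. The Iwasawa manifold is the
quotient `X = Γ \ G` by left translations. -/
def Γ : Set E := {g | ∀ i, ∃ a : GaussianInt, g i = GaussianInt.toComplex a}

/-! ### Complex valued differential forms -/

/-- Families of complex valued differential forms on `G = ℂ³`, one in each degree `k`: at each
point an `ℝ`-multilinear alternating map on the real tangent space `ℂ³`. -/
abbrev Forms : Type := (k : ℕ) → E → E [⋀^Fin k]→L[ℝ] ℂ

/-- The `ℂ`-linear part `u ↦ (L u - i L (i u)) / 2` of a real linear map. Applied to the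
derivative of a function it is `∑ i, ∂/∂zⁱ ⊗ dzⁱ`. For a form `α` seen as a linear map in one of
its arguments it is the insertion of the `(1,0)`-vector that corresponds to `u`, where
`∂/∂zⁱ` corresponds to the `i`-th basis vector of `ℂ³`. -/
def linPart {F : Type*} [NormedAddCommGroup F] [NormedSpace ℝ F] [NormedSpace ℂ F]
    [SMulCommClass ℝ ℂ F] (L : E →L[ℝ] F) : E →L[ℝ] F :=
  (1 / 2 : ℂ) • (L - Complex.I • (L ∘L (Complex.I • ContinuousLinearMap.id ℝ E)))

/-- The `ℂ`-antilinear part `u ↦ (L u + i L (i u)) / 2` of a real linear map. Applied to the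
derivative of a function it is `∑ i, ∂/∂z̄ⁱ ⊗ dz̄ⁱ`. -/
def antiPart {F : Type*} [NormedAddCommGroup F] [NormedSpace ℝ F] [NormedSpace ℂ F]
    [SMulCommClass ℝ ℂ F] (L : E →L[ℝ] F) : E →L[ℝ] F :=
  (1 / 2 : ℂ) • (L + Complex.I • (L ∘L (Complex.I • ContinuousLinearMap.id ℝ E)))

/-- The operator `∂`, that is `∑ i, dzⁱ ∧ ∂/∂zⁱ`. -/
def del (α : Forms) : Forms
  | 0 => 0
  | k + 1 => fun z => .alternatizeUncurryFin (linPart (fderiv ℝ (α k) z))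

/-- The operator `∂̄`, that is `∑ i, dz̄ⁱ ∧ ∂/∂z̄ⁱ`. -/
def delbar (α : Forms) : Forms
  | 0 => 0
  | k + 1 => fun z => .alternatizeUncurryFin (antiPart (fderiv ℝ (α k) z))

/-- `∂ + ∂̄` is the exterior derivative. -/
theorem del_add_delbar (α : Forms) (k : ℕ) (z : E) :
    del α (k + 1) z + delbar α (k + 1) z = extDeriv (α k) z := by
  rw [del, delbar, extDeriv, ← ContinuousAlternatingMap.alternatizeUncurryFin_add]
  congr 1
  ext u v
  simp [linPart, antiPart]
  ring

/-- The contraction `i_Φ` with a `(0,1)`-form `Φ` with values in `T^{1,0} ≅ ℂ³`: if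
`Φ = ∑ θ_a ⊗ η_a` then `i_Φ α = ∑ η_a ∧ (θ_a ⌟ α)`. -/
def contract (Φ : E → E →L[ℝ] E) (α : Forms) : Forms
  | 0 => 0
  | k + 1 => fun z => .alternatizeUncurryFin (linPart (α (k + 1) z).curryLeft ∘L Φ z)

/-- The pull-back by the left translation with `g`. -/
def pull (g : E) (α : Forms) : Forms :=
  fun k z => (α k (mul g z)).compContinuousLinearMap (fderiv ℝ (mul g) z)

/-- `α` is homogeneous of degree `p + q` and of type `(p, q)` at each point: a nonzero complex
number `c`, acting on the tangent spaces, multiplies it by `c ^ p * c̄ ^ q`. -/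
def IsType (p q : ℤ) (α : Forms) : Prop :=
  (∀ k : ℕ, (k : ℤ) ≠ p + q → α k = 0) ∧
  ∀ (k : ℕ) (z : E) (c : ℂ), c ≠ 0 → ∀ v : Fin k → E,
    α k z (fun j => c • v j) = c ^ p * conj c ^ q * α k z v

/-- The space `A^{p,q}(X)` of smooth `(p,q)`-forms on the Iwasawa manifold `X = Γ \ G`, that is of
the smooth `(p,q)`-forms on `G` that are invariant under `Γ`. -/
def A (p q : ℤ) : Submodule ℂ Forms where
  carrier := {α | (∀ k, ContDiff ℝ ∞ (α k)) ∧ IsType p q α ∧ ∀ g ∈ Γ, pull g α = α}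
  zero_mem' := by
    refine ⟨fun k => contDiff_const, ⟨fun k _ => rfl, fun k z c _ v => ?_⟩, fun g _ => ?_⟩
    · simp
    · ext k z v
      simp [pull]
  add_mem' := by
    rintro α η ⟨h1, ⟨h2, h3⟩, h4⟩ ⟨h1', ⟨h2', h3'⟩, h4'⟩
    refine ⟨fun k => (h1 k).add (h1' k), ⟨fun k hk => ?_, fun k z c hc v => ?_⟩, fun g hg => ?_⟩
    · simp [h2 k hk, h2' k hk]
    · simp [h3 k z c hc, h3' k z c hc, mul_add]
    · conv_rhs => rw [← h4 g hg, ← h4' g hg]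
      ext k z v
      simp [pull]
  smul_mem' := by
    rintro a α ⟨h1, ⟨h2, h3⟩, h4⟩
    refine ⟨fun k => (h1 k).const_smul a, ⟨fun k hk => ?_, fun k z c hc v => ?_⟩, fun g hg => ?_⟩
    · simp [h2 k hk]
    · simp [h3 k z c hc]
      ring
    · conv_rhs => rw [← h4 g hg]
      ext k z v
      simp [pull]

/-- The space `∧^{p,q} ⊂ A^{p,q}(X)` of left invariant forms. -/
def invForms (p q : ℤ) : Submodule ℂ Forms where
  carrier := {α | α ∈ A p q ∧ ∀ g : E, pull g α = α}
  zero_mem' := by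
    refine ⟨zero_mem _, fun g => ?_⟩
    ext k z v
    simp [pull]
  add_mem' := by
    rintro α η ⟨h1, h4⟩ ⟨h1', h4'⟩
    refine ⟨add_mem h1 h1', fun g => ?_⟩
    conv_rhs => rw [← h4 g, ← h4' g]
    ext k z v
    simp [pull]
  smul_mem' := by
    rintro a α ⟨h1, h4⟩
    refine ⟨Submodule.smul_mem _ a h1, fun g => ?_⟩
    conv_rhs => rw [← h4 g]
    ext k z v
    simp [pull]

/-! ### The Kuranishi family -/

/-- The parameters `t = (t_{iλ})`, `i = 1, 2, 3`, `λ = 1, 2` (numbered from `0`). -/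
abbrev Param : Type := Fin 3 → Fin 2 → ℂ

/-- `D(t) = t₁₁ t₂₂ - t₂₁ t₁₂`. -/
def D (t : Param) : ℂ := t 0 0 * t 1 1 - t 1 0 * t 0 1

/-- The Kuranishi space: a polydisc of radius `ε`. -/
def B (ε : ℝ) : Set Param := {t | ∀ i l, ‖t i l‖ < ε}

/-- The left invariant `(1,0)`-forms `φ¹ = dz¹`, `φ² = dz²`, `φ³ = dz³ - z¹ dz²`, at the point `z`
and evaluated on the tangent vector `u`. -/
def φ (z : E) : Fin 3 → E → ℂ := ![fun u => u 0, fun u => u 1, fun u => u 2 - z 0 * u 1]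

/-- The dual left invariant `(1,0)`-vector fields `θ¹ = ∂/∂z¹`, `θ² = ∂/∂z² + z¹ ∂/∂z³`,
`θ³ = ∂/∂z³`. -/
def θ (z : E) : Fin 3 → E := ![![1, 0, 0], ![0, 1, z 0], ![0, 0, 1]]

/-- The Beltrami differential
`φ(t) = ∑_{i ≤ 3} ∑_{λ ≤ 2} t_{iλ} θⁱ ⊗ φ̄^λ - D(t) θ³ ⊗ φ̄³` of the Kuranishi family, as an
antilinear map from the tangent space at `z` to `T^{1,0} ≅ ℂ³`. -/
def beltrami (t : Param) (z : E) : E →L[ℝ] E :=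
  LinearMap.toContinuousLinearMap
    { toFun := fun u =>
        (∑ i : Fin 3, ∑ l : Fin 2, (t i l * conj (φ z l.castSucc u)) • θ z i)
          - (D t * conj (φ z 2 u)) • θ z 2
      map_add' := by
        intro u v
        ext j
        simp [Fin.sum_univ_three, φ]
        ring
      map_smul' := by
        intro r u
        ext j
        simp [Fin.sum_univ_three, φ]
        ring }

/-- `∂̄_{φ(t)} = ∂̄ - (i_{φ(t)} ∂ - ∂ i_{φ(t)})`. -/
def delbarPhi (t : Param) (α : Forms) : Forms :=
  delbar α - (contract (beltrami t) (del α) - del (contract (beltrami t) α))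

/-! ### The operators preserve left invariant forms -/

theorem mem_invForms {p q : ℤ} {α : Forms} : α ∈ invForms p q ↔
    (∀ k, ContDiff ℝ ∞ (α k)) ∧ IsType p q α ∧ ∀ g : E, pull g α = α :=
  ⟨fun h => ⟨h.1.1, h.1.2.1, h.2⟩, fun h => ⟨⟨h.1, h.2.1, fun g _ => h.2.2 g⟩, h.2.2⟩⟩

section parts

variable {F : Type*} [NormedAddCommGroup F] [NormedSpace ℝ F] [NormedSpace ℂ F]

theorem map_complex_smul [IsScalarTower ℝ ℂ F] (L : E →L[ℝ] F) (c : ℂ) (w : E) :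
    L (c • w) = (c.re : ℂ) • L w + (c.im : ℂ) • L (Complex.I • w) := by
  have : c • w = c.re • w + c.im • (Complex.I • w) := by
    ext j
    simp only [Pi.smul_apply, Pi.add_apply, smul_eq_mul, Complex.real_smul]
    conv_lhs => rw [← Complex.re_add_im c]
    ring
  rw [this, map_add, map_smul, map_smul, ← algebraMap_smul ℂ c.re, ← algebraMap_smul ℂ c.im]
  rfl

variable [SMulCommClass ℝ ℂ F]

theorem linPart_apply (L : E →L[ℝ] F) (u : E) :
    linPart L u = (1 / 2 : ℂ) • (L u - Complex.I • L (Complex.I • u)) := by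
  simp [linPart]

theorem antiPart_apply (L : E →L[ℝ] F) (u : E) :
    antiPart L u = (1 / 2 : ℂ) • (L u + Complex.I • L (Complex.I • u)) := by
  simp [antiPart]

/-- The linear part is `ℂ`-linear. -/
theorem linPart_smul [IsScalarTower ℝ ℂ F] (L : E →L[ℝ] F) (c : ℂ) (u : E) :
    linPart L (c • u) = c • linPart L u := by
  have h3 : L (Complex.I • Complex.I • u) = - L u := by
    rw [smul_smul, Complex.I_mul_I, neg_one_smul, map_neg]
  rw [linPart_apply, linPart_apply, smul_comm Complex.I c u, map_complex_smul L c,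
    map_complex_smul L c, h3]
  have hc : c = (c.re : ℂ) + c.im * Complex.I := (Complex.re_add_im c).symm
  have hI : Complex.I * Complex.I = -1 := Complex.I_mul_I
  conv_rhs => rw [hc]
  match_scalars <;>
    first
    | ring1
    | linear_combination (-1 / 2 : ℂ) * c.im * hI
    | linear_combination (1 / 2 : ℂ) * c.im * hI

/-- The antilinear part is `ℂ`-antilinear. -/
theorem antiPart_smul [IsScalarTower ℝ ℂ F] (L : E →L[ℝ] F) (c : ℂ) (u : E) :
    antiPart L (c • u) = conj c • antiPart L u := by
  have h3 : L (Complex.I • Complex.I • u) = - L u := by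
    rw [smul_smul, Complex.I_mul_I, neg_one_smul, map_neg]
  rw [antiPart_apply, antiPart_apply, smul_comm Complex.I c u, map_complex_smul L c,
    map_complex_smul L c, h3]
  have hc : conj c = (c.re : ℂ) - c.im * Complex.I := by
    apply Complex.ext <;> simp
  have hI : Complex.I * Complex.I = -1 := Complex.I_mul_I
  rw [hc]
  match_scalars <;>
    first
    | ring1
    | linear_combination (-1 / 2 : ℂ) * c.im * hI
    | linear_combination (1 / 2 : ℂ) * c.im * hI

end parts

/-- The differential of the left translation with `g`. -/
theorem fderiv_mul (g z u : E) : fderiv ℝ (mul g) z u = ![u 0, u 1, u 2 + g 0 * u 1] := by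
  have h : HasFDerivAt (mul g) (LinearMap.toContinuousLinearMap
      ({ toFun := fun u => ![u 0, u 1, u 2 + g 0 * u 1]
         map_add' := by intro u v; ext j; fin_cases j <;> simp; ring
         map_smul' := by intro u v; ext j; fin_cases j <;> simp; ring } : E →ₗ[ℝ] E)) z := by
    set T := LinearMap.toContinuousLinearMap
      ({ toFun := fun u => ![u 0, u 1, u 2 + g 0 * u 1]
         map_add' := by intro u v; ext j; fin_cases j <;> simp; ring
         map_smul' := by intro u v; ext j; fin_cases j <;> simp; ring } : E →ₗ[ℝ] E) with hT
    have : mul g = fun z => g + T z := by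
      funext z
      ext j
      fin_cases j <;> simp [mul, hT] ; ring
    rw [this]
    exact T.hasFDerivAt.const_add g
  rw [h.fderiv]
  rfl

theorem fderiv_mul_const (g z w : E) : fderiv ℝ (mul g) z = fderiv ℝ (mul g) w := by
  ext u : 1
  rw [fderiv_mul, fderiv_mul]

theorem differentiable_mul (g : E) : Differentiable ℝ (mul g) := by
  rw [differentiable_pi]
  intro j
  fin_cases j <;> simp [mul] <;> fun_prop

theorem fderiv_mul_smul (g z : E) (c : ℂ) (u : E) :
    fderiv ℝ (mul g) z (c • u) = c • fderiv ℝ (mul g) z u := by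
  rw [fderiv_mul, fderiv_mul]
  ext j
  fin_cases j <;> simp
  ring

theorem beltrami_apply (t : Param) (z u : E) : beltrami t z u =
    (∑ i : Fin 3, ∑ l : Fin 2, (t i l * conj (φ z l.castSucc u)) • θ z i)
      - (D t * conj (φ z 2 u)) • θ z 2 := rfl

theorem beltrami_smul (t : Param) (z : E) (c : ℂ) (u : E) :
    beltrami t z (c • u) = conj c • beltrami t z u := by
  rw [beltrami_apply, beltrami_apply]
  ext j
  simp [Fin.sum_univ_three, φ]
  ring

theorem beltrami_invariant (t : Param) (g z u : E) :
    beltrami t (mul g z) (fderiv ℝ (mul g) z u) = fderiv ℝ (mul g) z (beltrami t z u) := by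
  rw [beltrami_apply, fderiv_mul, fderiv_mul, beltrami_apply]
  ext j
  fin_cases j <;> simp [Fin.sum_univ_three, φ, θ, mul] <;> ring

theorem contDiff_beltrami (t : Param) : ContDiff ℝ ∞ (beltrami t) := by
  rw [contDiff_clm_apply_iff]
  intro u
  have h : ∀ i : Fin 3, ContDiff ℝ ∞ fun z : E => (starRingEnd ℂ) (z i) := fun i =>
    (Complex.conjCLE : ℂ →L[ℝ] ℂ).contDiff.comp (contDiff_apply ℝ ℂ i)
  have h0 := h 0
  rw [contDiff_pi]
  intro j
  simp only [beltrami_apply]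
  fin_cases j <;> simp [Fin.sum_univ_three, φ, θ]
  all_goals fun_prop

theorem alternatize_type {k : ℕ} (M : E →L[ℝ] E [⋀^Fin k]→L[ℝ] ℂ) (c K : ℂ)
    (h : ∀ u w, M (c • u) (fun j => c • w j) = K * M u w) (v : Fin (k + 1) → E) :
    ContinuousAlternatingMap.alternatizeUncurryFin M (fun j => c • v j) =
      K * ContinuousAlternatingMap.alternatizeUncurryFin M v := by
  simp only [ContinuousAlternatingMap.alternatizeUncurryFin_apply, Finset.mul_sum]
  refine Finset.sum_congr rfl fun i _ => ?_
  rw [mul_smul_comm, ← h]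
  rfl

theorem alternatize_pull {k : ℕ} (M N : E →L[ℝ] E [⋀^Fin k]→L[ℝ] ℂ) (T : E →L[ℝ] E)
    (h : ∀ u w, N (T u) (fun j => T (w j)) = M u w) :
    (ContinuousAlternatingMap.alternatizeUncurryFin N).compContinuousLinearMap T =
      ContinuousAlternatingMap.alternatizeUncurryFin M := by
  ext v
  simp only [ContinuousAlternatingMap.compContinuousLinearMap_apply,
    ContinuousAlternatingMap.alternatizeUncurryFin_apply]
  refine Finset.sum_congr rfl fun i _ => ?_
  rw [← h]
  rfl

theorem linPart_eval {k : ℕ} (L : E →L[ℝ] E [⋀^Fin k]→L[ℝ] ℂ) (u : E) (w : Fin k → E) :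
    linPart L u w = (1 / 2 : ℂ) * (L u w - Complex.I * L (Complex.I • u) w) := by
  rw [linPart_apply]
  simp

theorem antiPart_eval {k : ℕ} (L : E →L[ℝ] E [⋀^Fin k]→L[ℝ] ℂ) (u : E) (w : Fin k → E) :
    antiPart L u w = (1 / 2 : ℂ) * (L u w + Complex.I * L (Complex.I • u) w) := by
  rw [antiPart_apply]
  simp [mul_add]

theorem fderiv_type {k : ℕ} {β : E → E [⋀^Fin k]→L[ℝ] ℂ} (hβ : Differentiable ℝ β) (c K : ℂ)
    (h : ∀ z v, β z (fun j => c • v j) = K * β z v) (z u : E) (w : Fin k → E) :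
    fderiv ℝ β z u (fun j => c • w j) = K * fderiv ℝ β z u w := by
  set C : (E [⋀^Fin k]→L[ℝ] ℂ) →L[ℝ] (E [⋀^Fin k]→L[ℝ] ℂ) :=
    ContinuousAlternatingMap.compContinuousLinearMapCLM (c • ContinuousLinearMap.id ℝ E) with hC
  have e : (fun z => C (β z)) = fun z => K • β z := by
    ext z v
    exact h z v
  have h1 : fderiv ℝ (fun z => C (β z)) z = C ∘L fderiv ℝ β z :=
    (C.hasFDerivAt.comp z (hβ z).hasFDerivAt).fderiv
  have h2 : fderiv ℝ (fun z => K • β z) z = K • fderiv ℝ β z :=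
    ((hβ z).hasFDerivAt.const_smul K).fderiv
  rw [e, h2] at h1
  exact (congrArg (fun L => L u w) h1).symm

theorem fderiv_pull {k : ℕ} {β : E → E [⋀^Fin k]→L[ℝ] ℂ} (hβ : Differentiable ℝ β) (g : E)
    (h : ∀ z, (β (mul g z)).compContinuousLinearMap (fderiv ℝ (mul g) z) = β z) (z u : E)
    (w : Fin k → E) :
    fderiv ℝ β (mul g z) (fderiv ℝ (mul g) z u) (fun j => fderiv ℝ (mul g) z (w j)) =
      fderiv ℝ β z u w := by
  set C : (E [⋀^Fin k]→L[ℝ] ℂ) →L[ℝ] (E [⋀^Fin k]→L[ℝ] ℂ) :=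
    ContinuousAlternatingMap.compContinuousLinearMapCLM (fderiv ℝ (mul g) z) with hC
  have e : (fun z => C (β (mul g z))) = β := by
    funext y
    rw [← h y, fderiv_mul_const g y z]
    rfl
  have h1 : fderiv ℝ (fun z => C (β (mul g z))) z =
      C ∘L (fderiv ℝ β (mul g z) ∘L fderiv ℝ (mul g) z) :=
    (C.hasFDerivAt.comp z
      ((hβ _).hasFDerivAt.comp z (differentiable_mul g z).hasFDerivAt)).fderiv
  rw [e] at h1
  exact (congrArg (fun L => L u w) h1).symm

theorem contDiff_alternatize {k : ℕ} {M : E → E →L[ℝ] E [⋀^Fin k]→L[ℝ] ℂ} (h : ContDiff ℝ ∞ M) :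
    ContDiff ℝ ∞ fun z => ContinuousAlternatingMap.alternatizeUncurryFin (M z) := by
  exact (ContinuousAlternatingMap.alternatizeUncurryFinCLM (n := k) ℝ E ℂ).contDiff.comp h

theorem linPart_type {k : ℕ} (L : E →L[ℝ] E [⋀^Fin k]→L[ℝ] ℂ) (c K : ℂ)
    (h : ∀ u w, L u (fun j => c • w j) = K * L u w) (u : E) (w : Fin k → E) :
    linPart L (c • u) (fun j => c • w j) = c * K * linPart L u w := by
  rw [linPart_smul, ContinuousAlternatingMap.smul_apply, linPart_eval, linPart_eval, h, h,
    smul_eq_mul]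
  ring

theorem antiPart_type {k : ℕ} (L : E →L[ℝ] E [⋀^Fin k]→L[ℝ] ℂ) (c K : ℂ)
    (h : ∀ u w, L u (fun j => c • w j) = K * L u w) (u : E) (w : Fin k → E) :
    antiPart L (c • u) (fun j => c • w j) = conj c * K * antiPart L u w := by
  rw [antiPart_smul, ContinuousAlternatingMap.smul_apply, antiPart_eval, antiPart_eval, h, h,
    smul_eq_mul]
  ring

theorem linPart_pull {k : ℕ} (L M : E →L[ℝ] E [⋀^Fin k]→L[ℝ] ℂ) (T : E →L[ℝ] E)
    (hT : ∀ (c : ℂ) u, T (c • u) = c • T u) (h : ∀ u w, L (T u) (fun j => T (w j)) = M u w)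
    (u : E) (w : Fin k → E) : linPart L (T u) (fun j => T (w j)) = linPart M u w := by
  rw [linPart_eval, linPart_eval, ← hT, h, h]

theorem antiPart_pull {k : ℕ} (L M : E →L[ℝ] E [⋀^Fin k]→L[ℝ] ℂ) (T : E →L[ℝ] E)
    (hT : ∀ (c : ℂ) u, T (c • u) = c • T u) (h : ∀ u w, L (T u) (fun j => T (w j)) = M u w)
    (u : E) (w : Fin k → E) : antiPart L (T u) (fun j => T (w j)) = antiPart M u w := by
  rw [antiPart_eval, antiPart_eval, ← hT, h, h]

theorem contDiff_linPart {k : ℕ} {M : E → E →L[ℝ] E [⋀^Fin k]→L[ℝ] ℂ} (h : ContDiff ℝ ∞ M) :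
    ContDiff ℝ ∞ fun z => linPart (M z) :=
  (h.sub ((h.clm_comp contDiff_const).const_smul Complex.I)).const_smul (1 / 2 : ℂ)

theorem contDiff_antiPart {k : ℕ} {M : E → E →L[ℝ] E [⋀^Fin k]→L[ℝ] ℂ} (h : ContDiff ℝ ∞ M) :
    ContDiff ℝ ∞ fun z => antiPart (M z) :=
  (h.add ((h.clm_comp contDiff_const).const_smul Complex.I)).const_smul (1 / 2 : ℂ)

theorem del_mem {p q : ℤ} {α : Forms} (h : α ∈ invForms p q) : del α ∈ invForms (p + 1) q := by
  obtain ⟨hs, ⟨hk, ht⟩, hg⟩ := mem_invForms.1 h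
  have hd : ∀ k, Differentiable ℝ (α k) := fun k => (hs k).differentiable (by simp)
  refine mem_invForms.2 ⟨fun k => ?_, ⟨fun k h0 => ?_, fun k z c hc v => ?_⟩, fun g => ?_⟩
  · cases k with
    | zero => exact contDiff_const
    | succ k => exact contDiff_alternatize (contDiff_linPart ((hs k).fderiv_right (by simp)))
  · cases k with
    | zero => rfl
    | succ k =>
      have : α k = 0 := hk k (by push_cast at h0; omega)
      funext z
      ext v
      simp [del, this, linPart, ContinuousAlternatingMap.alternatizeUncurryFin_apply]
  · cases k with
    | zero =>
      simp [del]
    | succ k =>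
      rw [zpow_add_one₀ hc, mul_comm (c ^ p) c, mul_assoc c]
      exact alternatize_type _ c _ (linPart_type _ c _
        (fderiv_type (hd k) c _ (fun z v => ht k z c hc v) z)) v
  · funext k z
    cases k with
    | zero => ext v; simp [pull, del]
    | succ k =>
      exact alternatize_pull _ _ _ (linPart_pull _ _ _ (fderiv_mul_smul g z)
        (fderiv_pull (hd k) g (fun y => congrFun (congrFun (hg g) k) y) z))

theorem delbar_mem {p q : ℤ} {α : Forms} (h : α ∈ invForms p q) :
    delbar α ∈ invForms p (q + 1) := by
  obtain ⟨hs, ⟨hk, ht⟩, hg⟩ := mem_invForms.1 h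
  have hd : ∀ k, Differentiable ℝ (α k) := fun k => (hs k).differentiable (by simp)
  refine mem_invForms.2 ⟨fun k => ?_, ⟨fun k h0 => ?_, fun k z c hc v => ?_⟩, fun g => ?_⟩
  · cases k with
    | zero => exact contDiff_const
    | succ k => exact contDiff_alternatize (contDiff_antiPart ((hs k).fderiv_right (by simp)))
  · cases k with
    | zero => rfl
    | succ k =>
      have : α k = 0 := hk k (by push_cast at h0; omega)
      funext z
      ext v
      simp [delbar, this, antiPart, ContinuousAlternatingMap.alternatizeUncurryFin_apply]
  · cases k with
    | zero =>
      simp [delbar]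
    | succ k =>
      have hc' : conj c ≠ 0 := (map_ne_zero _).2 hc
      rw [zpow_add_one₀ hc', mul_comm _ (conj c), mul_left_comm]
      exact alternatize_type _ c _ (antiPart_type _ c _
        (fderiv_type (hd k) c _ (fun z v => ht k z c hc v) z)) v
  · funext k z
    cases k with
    | zero => ext v; simp [pull, delbar]
    | succ k =>
      exact alternatize_pull _ _ _ (antiPart_pull _ _ _ (fderiv_mul_smul g z)
        (fderiv_pull (hd k) g (fun y => congrFun (congrFun (hg g) k) y) z))

theorem contDiff_curryLeft {k : ℕ} :
    ContDiff ℝ ∞ fun α : E [⋀^Fin (k + 1)]→L[ℝ] ℂ => α.curryLeft := by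
  have h : IsBoundedLinearMap ℝ fun α : E [⋀^Fin (k + 1)]→L[ℝ] ℂ => α.curryLeft :=
    { map_add := fun _ _ => rfl
      map_smul := fun _ _ => rfl
      bound := ⟨1, one_pos, fun α => by simp⟩ }
  exact h.contDiff

theorem contract_mem (t : Param) {p q : ℤ} {α : Forms} (h : α ∈ invForms p q) :
    contract (beltrami t) α ∈ invForms (p - 1) (q + 1) := by
  obtain ⟨hs, ⟨hk, ht⟩, hg⟩ := mem_invForms.1 h
  refine mem_invForms.2 ⟨fun k => ?_, ⟨fun k h0 => ?_, fun k z c hc v => ?_⟩, fun g => ?_⟩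
  · cases k with
    | zero => exact contDiff_const
    | succ k =>
      refine contDiff_alternatize (ContDiff.clm_comp (contDiff_linPart ?_) (contDiff_beltrami t))
      exact contDiff_curryLeft.comp (hs (k + 1))
  · cases k with
    | zero => rfl
    | succ k =>
      have : α (k + 1) = 0 := hk (k + 1) (by push_cast at h0 ⊢; omega)
      funext z
      ext v
      simp [contract, this, linPart, ContinuousAlternatingMap.alternatizeUncurryFin_apply]
  · cases k with
    | zero =>
      simp [contract]
    | succ k =>
      have key : ∀ (x : E) (w : Fin k → E),
          linPart (α (k + 1) z).curryLeft x (fun j => c • w j) =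
            c ^ (p - 1) * conj c ^ q * linPart (α (k + 1) z).curryLeft x w := by
        intro x w
        have h1 : ∀ y, (α (k + 1) z).curryLeft (c • y) (fun j => c • w j) =
            c ^ p * conj c ^ q * (α (k + 1) z).curryLeft y w := by
          intro y
          rw [ContinuousAlternatingMap.curryLeft_apply_apply,
            ContinuousAlternatingMap.curryLeft_apply_apply, ← ht _ z c hc]
          congr 1
          funext j
          cases j using Fin.cases <;> simp
        have h2 : linPart (α (k + 1) z).curryLeft (c • x) (fun j => c • w j) =
            c ^ p * conj c ^ q * linPart (α (k + 1) z).curryLeft x w := by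
          rw [linPart_eval, linPart_eval, smul_comm Complex.I c x, h1, h1]
          ring
        rw [linPart_smul, ContinuousAlternatingMap.smul_apply, smul_eq_mul] at h2
        apply mul_left_cancel₀ hc
        rw [h2, zpow_sub_one₀ hc]
        field_simp
      have hc' : conj c ≠ 0 := (map_ne_zero _).2 hc
      refine alternatize_type _ c _ (fun u w => ?_) v
      rw [ContinuousLinearMap.comp_apply, ContinuousLinearMap.comp_apply, beltrami_smul,
        linPart_smul, ContinuousAlternatingMap.smul_apply, key, zpow_add_one₀ hc', smul_eq_mul]
      ring
  · funext k z
    cases k with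
    | zero => ext v; simp [pull, contract]
    | succ k =>
      refine alternatize_pull _ _ _ (fun u w => ?_)
      rw [ContinuousLinearMap.comp_apply, ContinuousLinearMap.comp_apply, beltrami_invariant]
      refine linPart_pull _ _ _ (fderiv_mul_smul g z) (fun u w => ?_) _ w
      conv_rhs => rw [← congrFun (congrFun (hg g) (k + 1)) z]
      rw [pull, ContinuousAlternatingMap.curryLeft_compContinuousLinearMap]
      rfl

theorem delbarPhi_mem (t : Param) {p q : ℤ} {α : Forms} (h : α ∈ invForms p q) :
    delbarPhi t α ∈ invForms p (q + 1) := by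
  refine sub_mem (delbar_mem h) (sub_mem ?_ ?_)
  · simpa using contract_mem t (del_mem h)
  · simpa using del_mem (contract_mem t h)

theorem del_add {p q : ℤ} {α β : Forms} (h : α ∈ invForms p q) (h' : β ∈ invForms p q) :
    del (α + β) = del α + del β := by
  funext k z
  cases k with
  | zero => simp [del]
  | succ k =>
    have h1 := (h.1.1 k).differentiable (by simp) z
    have h2 := (h'.1.1 k).differentiable (by simp) z
    simp only [del, Pi.add_apply]
    rw [fderiv_add h1 h2, ← ContinuousAlternatingMap.alternatizeUncurryFin_add]
    congr 1
    ext u v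
    simp [linPart_eval]
    ring

theorem delbar_add {p q : ℤ} {α β : Forms} (h : α ∈ invForms p q) (h' : β ∈ invForms p q) :
    delbar (α + β) = delbar α + delbar β := by
  funext k z
  cases k with
  | zero => simp [delbar]
  | succ k =>
    have h1 := (h.1.1 k).differentiable (by simp) z
    have h2 := (h'.1.1 k).differentiable (by simp) z
    simp only [delbar, Pi.add_apply]
    rw [fderiv_add h1 h2, ← ContinuousAlternatingMap.alternatizeUncurryFin_add]
    congr 1
    ext u v
    simp [antiPart_eval]
    ring

theorem del_smul (a : ℂ) {p q : ℤ} {α : Forms} (h : α ∈ invForms p q) :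
    del (a • α) = a • del α := by
  funext k z
  cases k with
  | zero => ext v; simp [del]
  | succ k =>
    have h1 := (h.1.1 k).differentiable (by simp) z
    simp only [del, Pi.smul_apply]
    rw [fderiv_const_smul h1, ← ContinuousAlternatingMap.alternatizeUncurryFin_smul]
    congr 1
    ext u v
    simp [linPart_eval]
    ring

theorem delbar_smul (a : ℂ) {p q : ℤ} {α : Forms} (h : α ∈ invForms p q) :
    delbar (a • α) = a • delbar α := by
  funext k z
  cases k with
  | zero => ext v; simp [delbar]
  | succ k =>
    have h1 := (h.1.1 k).differentiable (by simp) z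
    simp only [delbar, Pi.smul_apply]
    rw [fderiv_const_smul h1, ← ContinuousAlternatingMap.alternatizeUncurryFin_smul]
    congr 1
    ext u v
    simp [antiPart_eval]
    ring

theorem contract_add (Φ : E → E →L[ℝ] E) (α β : Forms) :
    contract Φ (α + β) = contract Φ α + contract Φ β := by
  funext k z
  cases k with
  | zero => simp [contract]
  | succ k =>
    simp only [contract, Pi.add_apply]
    rw [← ContinuousAlternatingMap.alternatizeUncurryFin_add]
    congr 1
    ext u v
    simp [linPart_eval]
    ring

theorem contract_smul (a : ℂ) (Φ : E → E →L[ℝ] E) (α : Forms) :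
    contract Φ (a • α) = a • contract Φ α := by
  funext k z
  cases k with
  | zero => ext v; simp [contract]
  | succ k =>
    simp only [contract, Pi.smul_apply]
    rw [← ContinuousAlternatingMap.alternatizeUncurryFin_smul]
    congr 1
    ext u v
    simp [linPart_eval]
    ring

theorem delbarPhi_add (t : Param) {p q : ℤ} {α β : Forms} (h : α ∈ invForms p q)
    (h' : β ∈ invForms p q) : delbarPhi t (α + β) = delbarPhi t α + delbarPhi t β := by
  simp only [delbarPhi]
  rw [delbar_add h h', del_add h h', contract_add, contract_add,
    del_add (contract_mem t h) (contract_mem t h')]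
  abel

theorem delbarPhi_smul (t : Param) (a : ℂ) {p q : ℤ} {α : Forms} (h : α ∈ invForms p q) :
    delbarPhi t (a • α) = a • delbarPhi t α := by
  simp only [delbarPhi]
  rw [delbar_smul a h, del_smul a h, contract_smul, contract_smul, del_smul a (contract_mem t h)]
  simp only [smul_sub]

/-! ### Double complexes -/

/-- A bigraded complex vector space with operators of bidegree `(1,0)` and `(0,1)`. It is a double
complex if it satisfies `Bigraded.IsDoubleComplex`. -/
structure Bigraded where
  X : ℤ → ℤ → Type
  [grp : ∀ p q, AddCommGroup (X p q)]
  [mod : ∀ p q, Module ℂ (X p q)]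
  d1 : ∀ p q, X p q →ₗ[ℂ] X (p + 1) q
  d2 : ∀ p q, X p q →ₗ[ℂ] X p (q + 1)

attribute [instance] Bigraded.grp Bigraded.mod

/-- The condition `(∂₁ + ∂₂)² = 0`, by bidegrees: `K` is a double complex. -/
def Bigraded.IsDoubleComplex (K : Bigraded) : Prop :=
  ∀ p q (x : K.X p q),
    K.d1 (p + 1) q (K.d1 p q x) = 0 ∧
    K.d2 p (q + 1) (K.d2 p q x) = 0 ∧
    K.d1 p (q + 1) (K.d2 p q x) + K.d2 (p + 1) q (K.d1 p q x) = 0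

/-- Isomorphism of double complexes: linear bijections of bidegree `(0,0)` that commute with both
differentials. -/
def Bigraded.Isomorphic (K L : Bigraded) : Prop :=
  ∃ e : ∀ p q, K.X p q ≃ₗ[ℂ] L.X p q, ∀ p q (x : K.X p q),
    e (p + 1) q (K.d1 p q x) = L.d1 p q (e p q x) ∧
    e p (q + 1) (K.d2 p q x) = L.d2 p q (e p q x)

/-- The direct sum of a family. -/
def Bigraded.sum {ι : Type} (K : ι → Bigraded) : Bigraded where
  X p q := DirectSum ι fun i => (K i).X p q
  d1 p q := DirectSum.lmap fun i => (K i).d1 p q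
  d2 p q := DirectSum.lmap fun i => (K i).d2 p q

/-- `∂` on left invariant forms. -/
def delHom (p q : ℤ) : invForms p q →ₗ[ℂ] invForms (p + 1) q where
  toFun α := ⟨del α.1, del_mem α.2⟩
  map_add' α β := Subtype.ext (del_add α.2 β.2)
  map_smul' a α := Subtype.ext (del_smul a α.2)

/-- `∂̄_{φ(t)}` on left invariant forms. -/
def delbarPhiHom (t : Param) (p q : ℤ) : invForms p q →ₗ[ℂ] invForms p (q + 1) where
  toFun α := ⟨delbarPhi t α.1, delbarPhi_mem t α.2⟩
  map_add' α β := Subtype.ext (delbarPhi_add t α.2 β.2)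
  map_smul' a α := Subtype.ext (delbarPhi_smul t a α.2)

/-- The double complex `(∧^{•,•}, ∂, ∂̄_{φ(t)})` of left invariant forms on the Iwasawa
manifold. -/
def invComplex (t : Param) : Bigraded where
  X p q := invForms p q
  d1 := delHom
  d2 := delbarPhiHom t

/-! ### Squares and zigzags -/

/-- The component in bidegree `(p, q)` of `C(S)`: `ℂ` if `(p, q) ∈ S` and `0` otherwise. -/
def comp (S : Finset (ℤ × ℤ)) (p q : ℤ) : Submodule ℂ ℂ where
  carrier := {x | (p, q) ∉ S → x = 0}
  zero_mem' := fun _ => rfl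
  add_mem' := fun ha hb h => by rw [ha h, hb h, add_zero]
  smul_mem' := fun a x hx h => by rw [hx h, smul_zero]

/-- `C(S)`: one dimensional components in the bidegrees in `S`, with `∂₁ = (-1)^q` and `∂₂ = 1`
wherever source and target both lie in `S`. -/
def C (S : Finset (ℤ × ℤ)) : Bigraded where
  X p q := comp S p q
  d1 p q :=
    { toFun := fun x => ⟨if (p + 1, q) ∈ S then (-1) ^ q * x.1 else 0, fun h => if_neg h⟩
      map_add' := by
        intro x y
        ext
        by_cases h : (p + 1, q) ∈ S <;> simp [h, mul_add]
      map_smul' := by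
        intro a x
        ext
        by_cases h : (p + 1, q) ∈ S <;> simp [h, mul_left_comm] }
  d2 p q :=
    { toFun := fun x => ⟨if (p, q + 1) ∈ S then x.1 else 0, fun h => if_neg h⟩
      map_add' := by
        intro x y
        ext
        by_cases h : (p, q + 1) ∈ S <;> simp [h]
      map_smul' := by
        intro a x
        ext
        by_cases h : (p, q + 1) ∈ S <;> simp [h] }

/-- The vertices of the infinite staircase
`⋯ ← (p, q) → (p + 1, q) ← (p + 1, q - 1) → (p + 2, q - 1) ← ⋯`
through `(p, q)`, which is vertex number `0`. -/
def staircase (p q j : ℤ) : ℤ × ℤ := (p + (j + 1) / 2, q - j / 2)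

/-- The shape of a zigzag: a finite nonempty connected piece of a staircase. -/
def IsZigzag (S : Finset (ℤ × ℤ)) : Prop :=
  ∃ p q a b : ℤ, a ≤ b ∧ S = (Finset.Icc a b).image (staircase p q)

/-- The square with lower left corner `(p, q)`. -/
def square (p q : ℤ) : Finset (ℤ × ℤ) := {(p, q), (p + 1, q), (p, q + 1), (p + 1, q + 1)}

/-- The shape of a square. -/
def IsSquare (S : Finset (ℤ × ℤ)) : Prop := ∃ p q : ℤ, S = square p q

/-- `K` is isomorphic to the direct sum of the `C(S)` for `S` in the list `L`, which consists of
shapes of squares and zigzags. -/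
def DecomposesAs (K : Bigraded) (L : List (Finset (ℤ × ℤ))) : Prop :=
  (∀ S ∈ L, IsSquare S ∨ IsZigzag S) ∧
    K.Isomorphic (Bigraded.sum fun i : Fin L.length => C (L.get i))

/-! ### The three diagrams -/

/-- A dot. -/
def dot (p q : ℤ) : Finset (ℤ × ℤ) := {(p, q)}

/-- A single horizontal arrow `(p, q) → (p + 1, q)`. -/
def hArrow (p q : ℤ) : Finset (ℤ × ℤ) := {(p, q), (p + 1, q)}

/-- A single vertical arrow `(p, q) → (p, q + 1)`. -/
def vArrow (p q : ℤ) : Finset (ℤ × ℤ) := {(p, q), (p, q + 1)}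

/-- Two arrows `(p, q + 1) ← (p, q) → (p + 1, q)` with a common source. -/
def fork (p q : ℤ) : Finset (ℤ × ℤ) := {(p, q + 1), (p, q), (p + 1, q)}

/-- Two arrows `(p - 1, q) → (p, q) ← (p, q - 1)` with a common target. -/
def joint (p q : ℤ) : Finset (ℤ × ℤ) := {(p - 1, q), (p, q), (p, q - 1)}

/-- `n` copies of a shape. -/
abbrev copies (n : ℕ) (S : Finset (ℤ × ℤ)) : List (Finset (ℤ × ℤ)) := List.replicate n S

/-- The components that occur in all three diagrams. -/
def diagram0 : List (Finset (ℤ × ℤ)) :=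
  [square 1 1] ++
  copies 1 (vArrow 0 1) ++ copies 2 (vArrow 1 1) ++ copies 2 (vArrow 2 1) ++
    copies 1 (vArrow 3 1) ++
  copies 1 (dot 0 0) ++ copies 2 (dot 1 0) ++ copies 1 (dot 3 0) ++
  copies 2 (dot 0 1) ++ copies 3 (dot 1 1) ++ copies 4 (dot 2 1) ++ copies 2 (dot 3 1) ++
  copies 2 (dot 0 2) ++ copies 4 (dot 1 2) ++ copies 3 (dot 2 2) ++ copies 2 (dot 3 2) ++
  copies 1 (dot 0 3) ++ copies 2 (dot 2 3) ++ copies 1 (dot 3 3)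

/-- The diagram for `(t₁₁, t₁₂, t₂₁, t₂₂) = 0`. -/
def diagram1 : List (Finset (ℤ × ℤ)) :=
  diagram0 ++
  copies 1 (hArrow 1 0) ++ copies 2 (hArrow 1 1) ++ copies 2 (hArrow 1 2) ++
    copies 1 (hArrow 1 3) ++
  copies 2 (dot 2 0) ++ copies 1 (dot 1 1) ++ copies 1 (dot 2 2) ++ copies 2 (dot 1 3)

/-- The diagram for `(t₁₁, t₁₂, t₂₁, t₂₂) ≠ 0` and `D(t) = 0`. -/
def diagram2 : List (Finset (ℤ × ℤ)) :=
  diagram0 ++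
  copies 1 (fork 1 0) ++ copies 1 (joint 2 1) ++ copies 1 (hArrow 1 1) ++
    copies 1 (hArrow 1 2) ++ copies 1 (fork 1 2) ++ copies 1 (joint 2 3) ++
  copies 1 (dot 2 0) ++ copies 1 (dot 1 3)

/-- The diagram for `D(t) ≠ 0`. -/
def diagram3 : List (Finset (ℤ × ℤ)) :=
  diagram0 ++
  copies 1 (fork 1 0) ++ copies 2 (joint 2 1) ++ copies 2 (fork 1 2) ++ copies 1 (joint 2 3)

/-! ### Isomorphism types in the family -/

/-- Isomorphism of the double complexes of left invariant forms at two points of the family. -/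
def isoSetoid (ε : ℝ) : Setoid (B ε) where
  r s t := (invComplex s.1).Isomorphic (invComplex t.1)
  iseqv :=
    { refl := fun t => ⟨fun p q => LinearEquiv.refl ℂ _, fun p q x => ⟨rfl, rfl⟩⟩
      symm := by
        rintro s t ⟨e, he⟩
        refine ⟨fun p q => (e p q).symm, fun p q x => ⟨?_, ?_⟩⟩
        · rw [LinearEquiv.symm_apply_eq, (he _ _ _).1, LinearEquiv.apply_symm_apply]
        · rw [LinearEquiv.symm_apply_eq, (he _ _ _).2, LinearEquiv.apply_symm_apply]
      trans := by
        rintro s t u ⟨e, he⟩ ⟨f, hf⟩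
        refine ⟨fun p q => (e p q).trans (f p q), fun p q x => ⟨?_, ?_⟩⟩
        · simp only [LinearEquiv.trans_apply, (he _ _ _).1, (hf _ _ _).1]
        · simp only [LinearEquiv.trans_apply, (he _ _ _).2, (hf _ _ _).2] }

end Iwasawa

end

noncomputable section
open scoped ContDiff ComplexConjugate
namespace Iwasawa

/-! ### Exterior and interior multiplication -/

/-! Left invariant forms on `G` are the exterior algebra on the six forms `φʲ`, `φ̄ʲ`. Exterior
multiplication by these forms and insertion of the dual vector fields satisfy the canonical
anticommutation relations (`stdE_isCAR`), and this Fock space structure (`IsFock`,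
`invForms_isFock`) is all that is needed afterwards: the 64 monomials form a basis and every
operator is computed on them.

In these terms the structure equation `dφ³ = -φ¹ ∧ φ²` says that `∂ = -e₁e₂i₃`, and likewise `∂̄ =
-ē₁ē₂ī₃` (`del_invariant`, `delbar_invariant`). Contraction with the Beltrami differential is a sum
of terms `ē i`. In its commutator with `∂` only the components along `θ¹` and `θ²` survive
(`IsCAR.commutator`), hence `∂̄_{φ(t)} = ∂̄ + (e₁(t₂₁ē₁ + t₂₂ē₂) - e₂(t₁₁ē₁ + t₁₂ē₂)) i₃`. Neither
`t₃₁`, `t₃₂` nor the coefficient `-D(t)` of `θ³ φ̄³` matters; only the 2×2 matrix `(t_{iλ})`, `i ≤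
2`, remains.

A unimodular change of `e₁, e₂` preserves `∂`. An invertible change of `ē₁, ē₂` preserves `∂̄` if
`φ̄³` is rescaled by the determinant. Such changes bring the matrix to a normal form that depends
only on its rank 0, 1 or 2 (`exists_adapted_frame`). There is thus one double complex with integral
structure constants for each rank, and its relations and an explicit basis of squares and zigzags
are verified by a finite computation (`act_act`, `isDecomposition_zero`, `isDecomposition_one`,
`isDecomposition_two`).

Conversely, the rank is an isomorphism invariant: it is the rank of the second differential in
bidegree `(2, 0)`, which the predicates `RankZero` and `RankLeOne` detect (`isomorphic_iff`). All
three ranks occur in every polydisc. This gives the three types, and also the "only if" parts, since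
each diagram is realized by a member of the family of known rank. -/

/-- The tensor product `f ⊗ β` of a complex valued `1`-form with a `k`-form. -/
def tens {k : ℕ} (f : E →L[ℝ] ℂ) (β : E [⋀^Fin k]→L[ℝ] ℂ) : E →L[ℝ] E [⋀^Fin k]→L[ℝ] ℂ :=
  ((ContinuousLinearMap.toSpanSingleton ℂ β).restrictScalars ℝ) ∘L f

@[simp]
theorem tens_apply {k : ℕ} (f : E →L[ℝ] ℂ) (β : E [⋀^Fin k]→L[ℝ] ℂ) (u : E) :
    tens f β u = f u • β := rfl

/-- Exterior multiplication from the left by the `1`-form `f`. -/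
def wedge (f : E → E →L[ℝ] ℂ) : Forms →ₗ[ℂ] Forms where
  toFun α
    | 0 => 0
    | k + 1 => fun z => .alternatizeUncurryFin (tens (f z) (α k z))
  map_add' α β := by
    funext k z
    cases k with
    | zero => ext v; simp
    | succ k =>
      ext v
      simp [ContinuousAlternatingMap.alternatizeUncurryFin_apply, Finset.sum_add_distrib]
  map_smul' a α := by
    funext k z
    cases k with
    | zero => ext v; simp
    | succ k =>
      ext v
      simp [ContinuousAlternatingMap.alternatizeUncurryFin_apply, Finset.mul_sum, mul_left_comm]

/-- Insertion of the complex vector field `X + i Y` into the first argument. -/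
def insertion (X Y : E → E) : Forms →ₗ[ℂ] Forms where
  toFun α k z := (α (k + 1) z).curryLeft (X z) + Complex.I • (α (k + 1) z).curryLeft (Y z)
  map_add' α β := by
    ext k z v
    simp
    ring
  map_smul' a α := by
    ext k z v
    simp
    ring

theorem wedge_zero_apply (f : E → E →L[ℝ] ℂ) (α : Forms) (z : E) : wedge f α 0 z = 0 := rfl

theorem wedge_succ_apply (f : E → E →L[ℝ] ℂ) (α : Forms) (k : ℕ) (z : E) :
    wedge f α (k + 1) z = .alternatizeUncurryFin (tens (f z) (α k z)) := rfl

theorem insertion_apply (X Y : E → E) (α : Forms) (k : ℕ) (z : E) (v : Fin k → E) :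
    insertion X Y α k z v =
      α (k + 1) z (Matrix.vecCons (X z) v) + Complex.I * α (k + 1) z (Matrix.vecCons (Y z) v) :=
  rfl

/-- The tensor `f ⊗ g + g ⊗ f` is symmetric, and alternating twice over a symmetric bilinear map
gives zero. In degrees 0 and 1 both sides vanish. -/
theorem wedge_wedge (f g : E → E →L[ℝ] ℂ) (α : Forms) :
    wedge f (wedge g α) = -wedge g (wedge f α) := by
  have key : ∀ (k : ℕ) (a b : E →L[ℝ] ℂ) (β : E [⋀^Fin k]→L[ℝ] ℂ),
      ContinuousAlternatingMap.alternatizeUncurryFin (tens a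
        (ContinuousAlternatingMap.alternatizeUncurryFin (tens b β))) +
      ContinuousAlternatingMap.alternatizeUncurryFin (tens b
        (ContinuousAlternatingMap.alternatizeUncurryFin (tens a β))) = 0 := by
    intro k a b β
    let T : (E →L[ℝ] ℂ) → (E →L[ℝ] ℂ) → E →L[ℝ] E →L[ℝ] E [⋀^Fin k]→L[ℝ] ℂ := fun a b =>
      LinearMap.toContinuousLinearMap
        { toFun := fun u => a u • tens b β
          map_add' := fun u v => by ext; simp; ring
          map_smul' := fun r u => by ext; simp; ring }
    have hT : ∀ a b, ContinuousAlternatingMap.alternatizeUncurryFin (tens a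
        (ContinuousAlternatingMap.alternatizeUncurryFin (tens b β))) =
        ContinuousAlternatingMap.alternatizeUncurryFin
          (ContinuousAlternatingMap.alternatizeUncurryFinCLM ℝ E ℂ ∘L T a b) := by
      intro a b
      congr 1
      ext u : 1
      simp [T]
    rw [hT, hT, ← ContinuousAlternatingMap.alternatizeUncurryFin_add,
      ← ContinuousLinearMap.comp_add]
    refine ContinuousAlternatingMap.alternatizeUncurryFin_alternatizeUncurryFinCLM_comp_of_symmetric
      fun x y => ?_
    ext v
    simp [T]
    ring
  rw [eq_neg_iff_add_eq_zero]
  funext k z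
  match k with
  | 0 => simp [wedge_zero_apply]
  | 1 =>
    ext v
    simp [wedge_succ_apply, wedge_zero_apply, ContinuousAlternatingMap.alternatizeUncurryFin_apply]
  | k + 2 => exact key k (f z) (g z) (α k z)

/-- Expand the alternating sum along the first slot. The term in which `f` meets the inserted vector
is `c • α`; in all others `f` sits in a later slot, and the shift of the index by one produces the
minus sign. -/
theorem insertion_wedge (X Y : E → E) (f : E → E →L[ℝ] ℂ) (c : ℂ)
    (h : ∀ z, f z (X z) + Complex.I * f z (Y z) = c) (α : Forms) :
    insertion X Y (wedge f α) = c • α - wedge f (insertion X Y α) := by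
  have key : ∀ (k : ℕ) (a : E →L[ℝ] ℂ) (β : E [⋀^Fin (k + 1)]→L[ℝ] ℂ) (x : E) (v : Fin (k + 1) → E),
      ContinuousAlternatingMap.alternatizeUncurryFin (tens a β) (Matrix.vecCons x v) =
      a x * β v - ∑ i : Fin (k + 1), (-1) ^ (i : ℕ) * (a (v i) *
          β (Matrix.vecCons x (i.removeNth v))) := by
    intro k a β x v
    rw [ContinuousAlternatingMap.alternatizeUncurryFin_apply, Fin.sum_univ_succ, sub_eq_add_neg,
      ← Finset.sum_neg_distrib]
    congr 1
    · simp
    · refine Finset.sum_congr rfl fun i _ => ?_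
      have : Fin.removeNth i.succ (Matrix.vecCons x v) = Matrix.vecCons x (i.removeNth v) := by
        funext j
        cases j using Fin.cases <;> simp [Fin.removeNth]
      rw [this]
      simp [pow_succ]
  funext k z
  ext v
  rw [insertion_apply]
  match k with
  | 0 =>
    simp only [wedge_succ_apply, ContinuousAlternatingMap.alternatizeUncurryFin_apply, ← h z]
    simp [wedge_zero_apply]
    have : ∀ w : Fin 0 → E, α 0 z w = α 0 z v := fun w => congrArg _ (Subsingleton.elim _ _)
    rw [this, this]
    ring
  | k + 1 =>
    rw [wedge_succ_apply, key, key]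
    simp only [Pi.sub_apply, Pi.smul_apply, ContinuousAlternatingMap.sub_apply,
      ContinuousAlternatingMap.smul_apply, wedge_succ_apply,
      ContinuousAlternatingMap.alternatizeUncurryFin_apply, tens_apply, insertion_apply, ← h z,
      smul_eq_mul, Int.reduceNeg, mul_add, mul_sub, Finset.mul_sum]
    simp only [zsmul_eq_mul, mul_add, Finset.sum_add_distrib, Int.cast_pow, Int.cast_neg,
      Int.cast_one, mul_left_comm Complex.I]
    ring

/-- Exchanging the first two arguments of an alternating form changes its sign. -/
theorem insertion_insertion (X Y X' Y' : E → E) (α : Forms) :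
    insertion X Y (insertion X' Y' α) = -insertion X' Y' (insertion X Y α) := by
  have key : ∀ (k : ℕ) (β : E [⋀^Fin (k + 2)]→L[ℝ] ℂ) (x y : E) (v : Fin k → E),
      β (Matrix.vecCons x (Matrix.vecCons y v)) = -β (Matrix.vecCons y (Matrix.vecCons x v)) := by
    intro k β x y v
    have h := β.toAlternatingMap.map_swap (Matrix.vecCons y (Matrix.vecCons x v))
      (show (0 : Fin (k + 2)) ≠ 1 by simp)
    refine Eq.trans ?_ h
    refine congrArg β ?_
    funext j
    cases j using Fin.cases with
    | zero => simp
    | succ j =>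
      cases j using Fin.cases with
      | zero => simp
      | succ j =>
        rw [Function.comp_apply, Equiv.swap_apply_of_ne_of_ne] <;> simp [Fin.ext_iff]
  funext k z
  ext v
  simp only [Pi.neg_apply, ContinuousAlternatingMap.neg_apply, insertion_apply]
  rw [key k _ (X' z), key k _ (X' z), key k _ (Y' z), key k _ (Y' z)]
  ring

/-! ### The left invariant frame and coframe -/

/-- The form `φʲ` as a continuous linear map on each tangent space. -/
def coframe (j : Fin 3) (z : E) : E →L[ℝ] ℂ :=
  LinearMap.toContinuousLinearMap
    { toFun := φ z j
      map_add' := by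
        intro u v
        fin_cases j <;> simp [φ]
        ring
      map_smul' := by
        intro r u
        fin_cases j <;> simp [φ]
        ring }

/-- The form `φ̄ʲ`. -/
def coframeBar (j : Fin 3) (z : E) : E →L[ℝ] ℂ := (Complex.conjCLE : ℂ →L[ℝ] ℂ) ∘L coframe j z

theorem coframe_apply (j : Fin 3) (z u : E) : coframe j z u = φ z j u := rfl

theorem coframeBar_apply (j : Fin 3) (z u : E) : coframeBar j z u = conj (φ z j u) := rfl

/-- Insertion of `θⱼ`. -/
def insertFrame (j : Fin 3) : Forms →ₗ[ℂ] Forms :=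
  insertion (fun z => (1 / 2 : ℂ) • θ z j) (fun z => (-Complex.I / 2) • θ z j)

/-- Insertion of `θ̄ⱼ`. -/
def insertFrameBar (j : Fin 3) : Forms →ₗ[ℂ] Forms :=
  insertion (fun z => (1 / 2 : ℂ) • θ z j) (fun z => (Complex.I / 2) • θ z j)

theorem φ_smul (z : E) (j : Fin 3) (c : ℂ) (u : E) : φ z j (c • u) = c * φ z j u := by
  fin_cases j <;> simp [φ]
  ring

theorem φ_θ (z : E) (i j : Fin 3) : φ z i (θ z j) = if i = j then 1 else 0 := by
  fin_cases i <;> fin_cases j <;> simp [φ, θ]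

theorem sum_φ_smul_θ (z u : E) : ∑ j, φ z j u • θ z j = u := by
  ext j
  fin_cases j <;> simp [Fin.sum_univ_three, φ, θ]
  ring

theorem φ_invariant (j : Fin 3) (g z u : E) :
    φ (mul g z) j (fderiv ℝ (mul g) z u) = φ z j u := by
  rw [fderiv_mul]
  fin_cases j <;> simp [φ, mul]
  ring

theorem θ_invariant (j : Fin 3) (g z : E) : θ (mul g z) j = fderiv ℝ (mul g) z (θ z j) := by
  rw [fderiv_mul]
  ext i
  fin_cases j <;> fin_cases i <;> simp [θ, mul]
  ring

theorem contDiff_coframe (j : Fin 3) : ContDiff ℝ ∞ (coframe j) := by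
  rw [contDiff_clm_apply_iff]
  intro u
  simp only [coframe_apply]
  fin_cases j <;> simp [φ] <;> fun_prop

theorem contDiff_coframeBar (j : Fin 3) : ContDiff ℝ ∞ (coframeBar j) :=
  contDiff_const.clm_comp (contDiff_coframe j)

theorem contDiff_θ (j : Fin 3) : ContDiff ℝ ∞ fun z => θ z j := by
  rw [contDiff_pi]
  intro i
  fin_cases j <;> fin_cases i <;> simp [θ] <;> fun_prop

/-- Forms are only real-linear in their arguments, so the factor has to be read as a real number
before it can be pulled out. -/
theorem half_smul (u : E) : (1 / 2 : ℂ) • u = (1 / 2 : ℝ) • u := by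
  ext j
  simp

/-- The vector `(θ - iJθ) / 2` is the `(1,0)`-part of the real tangent vector `θ`, where `J` is
multiplication by `i` on `ℂ³`. -/
theorem insertFrame_apply (j : Fin 3) (α : Forms) (k : ℕ) (z : E) :
    insertFrame j α k z = linPart (α (k + 1) z).curryLeft (θ z j) := by
  have h : (-Complex.I / 2) • θ z j = (-1 / 2 : ℝ) • (Complex.I • θ z j) := by
    ext
    simp
    ring
  ext v
  rw [linPart_eval, insertFrame, insertion]
  simp only [LinearMap.coe_mk, AddHom.coe_mk, half_smul, h, map_smul]
  simp
  ring

theorem insertFrameBar_apply (j : Fin 3) (α : Forms) (k : ℕ) (z : E) :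
    insertFrameBar j α k z = antiPart (α (k + 1) z).curryLeft (θ z j) := by
  have h : (Complex.I / 2) • θ z j = (1 / 2 : ℝ) • (Complex.I • θ z j) := by
    ext
    simp
    ring
  ext v
  rw [antiPart_eval, insertFrameBar, insertion]
  simp only [LinearMap.coe_mk, AddHom.coe_mk, half_smul, h, map_smul]
  simp
  ring

/-! ### The operators preserve left invariant forms -/

theorem contDiff_wedge {f : E → E →L[ℝ] ℂ} (hf : ContDiff ℝ ∞ f) {α : Forms}
    (hα : ∀ k, ContDiff ℝ ∞ (α k)) (k : ℕ) : ContDiff ℝ ∞ (wedge f α k) := by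
  cases k with
  | zero => exact contDiff_const
  | succ k =>
    refine contDiff_alternatize ?_
    rw [contDiff_clm_apply_iff]
    intro u
    exact (hf.clm_apply contDiff_const).smul (hα k)

theorem pull_wedge {f : E → E →L[ℝ] ℂ} {α : Forms} {g : E}
    (hf : ∀ z u, f (mul g z) (fderiv ℝ (mul g) z u) = f z u) (hα : pull g α = α) :
    pull g (wedge f α) = wedge f α := by
  funext k z
  cases k with
  | zero => ext v; simp [pull, wedge_zero_apply]
  | succ k =>
    refine alternatize_pull _ _ _ fun u w => ?_
    rw [tens_apply, tens_apply, hf]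
    conv_rhs => rw [← hα]
    rfl

theorem wedge_type {f : E → E →L[ℝ] ℂ} {α : Forms} {c a K : ℂ}
    (hf : ∀ z u, f z (c • u) = a * f z u)
    (hα : ∀ (k : ℕ) z (v : Fin k → E), α k z (fun j => c • v j) = K * α k z v)
    (k : ℕ) (z : E) (v : Fin k → E) :
    wedge f α k z (fun j => c • v j) = a * K * wedge f α k z v := by
  cases k with
  | zero => simp [wedge_zero_apply]
  | succ k =>
    refine alternatize_type _ _ _ (fun u w => ?_) v
    simp [hf, hα]
    ring

theorem wedge_coframe_mem (j : Fin 3) {p q : ℤ} {α : Forms} (h : α ∈ invForms p q) :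
    wedge (coframe j) α ∈ invForms (p + 1) q := by
  obtain ⟨hs, ⟨hk, ht⟩, hg⟩ := mem_invForms.1 h
  refine mem_invForms.2 ⟨contDiff_wedge (contDiff_coframe j) hs, ⟨fun k h0 => ?_,
    fun k z c hc v => ?_⟩, fun g => pull_wedge (φ_invariant j g) (hg g)⟩
  · cases k with
    | zero => rfl
    | succ k =>
      have : α k = 0 := hk k (by push_cast at h0; omega)
      funext z
      ext v
      simp [wedge_succ_apply, this, ContinuousAlternatingMap.alternatizeUncurryFin_apply]
  · rw [wedge_type (fun z u => φ_smul z j c u) (fun k z v => ht k z c hc v), zpow_add_one₀ hc]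
    ring

theorem wedge_coframeBar_mem (j : Fin 3) {p q : ℤ} {α : Forms} (h : α ∈ invForms p q) :
    wedge (coframeBar j) α ∈ invForms p (q + 1) := by
  obtain ⟨hs, ⟨hk, ht⟩, hg⟩ := mem_invForms.1 h
  refine mem_invForms.2 ⟨contDiff_wedge (contDiff_coframeBar j) hs, ⟨fun k h0 => ?_,
    fun k z c hc v => ?_⟩, fun g => pull_wedge (fun z u => ?_) (hg g)⟩
  · cases k with
    | zero => rfl
    | succ k =>
      have : α k = 0 := hk k (by push_cast at h0; omega)
      funext z
      ext v
      simp [wedge_succ_apply, this, ContinuousAlternatingMap.alternatizeUncurryFin_apply]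
  · rw [wedge_type (a := conj c) (fun z u => ?_) (fun k z v => ht k z c hc v),
      zpow_add_one₀ ((map_ne_zero _).2 hc)]
    · ring
    · rw [coframeBar_apply, coframeBar_apply, φ_smul, map_mul]
  · rw [coframeBar_apply, coframeBar_apply, φ_invariant]

theorem curryLeft_type {k : ℕ} {β : E [⋀^Fin (k + 1)]→L[ℝ] ℂ} {c K : ℂ}
    (h : ∀ v, β (fun j => c • v j) = K * β v) (y : E) (w : Fin k → E) :
    β.curryLeft (c • y) (fun j => c • w j) = K * β.curryLeft y w := by
  rw [ContinuousAlternatingMap.curryLeft_apply_apply,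
    ContinuousAlternatingMap.curryLeft_apply_apply, ← h]
  congr 1
  funext j
  cases j using Fin.cases <;> simp

theorem curryLeft_pull {α : Forms} {g : E} (hg : pull g α = α) (k : ℕ) (z u : E) (w : Fin k → E) :
    (α (k + 1) (mul g z)).curryLeft (fderiv ℝ (mul g) z u) (fun j => fderiv ℝ (mul g) z (w j)) =
      (α (k + 1) z).curryLeft u w := by
  conv_rhs => rw [← congrFun (congrFun hg (k + 1)) z]
  rw [pull, ContinuousAlternatingMap.curryLeft_compContinuousLinearMap]
  rfl

theorem insertFrame_mem (j : Fin 3) {p q : ℤ} {α : Forms} (h : α ∈ invForms p q) :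
    insertFrame j α ∈ invForms (p - 1) q := by
  obtain ⟨hs, ⟨hk, ht⟩, hg⟩ := mem_invForms.1 h
  refine mem_invForms.2 ⟨fun k => ?_, ⟨fun k h0 => ?_, fun k z c hc v => ?_⟩, fun g => ?_⟩
  · simp only [funext (insertFrame_apply j α k)]
    exact (contDiff_linPart (contDiff_curryLeft.comp (hs (k + 1)))).clm_apply (contDiff_θ j)
  · have : α (k + 1) = 0 := hk (k + 1) (by push_cast at h0 ⊢; omega)
    funext z
    ext v
    simp [insertFrame_apply, this, linPart_eval]
  · rw [insertFrame_apply]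
    -- Scaling all arguments, the inserted one included, gives `c ^ p * conj c ^ q`. The inserted
    -- slot alone accounts for one factor `c` by complex linearity; cancelling it leaves the
    -- exponent `p - 1`.
    have h2 : linPart (α (k + 1) z).curryLeft (c • θ z j) (fun j => c • v j) =
        c ^ p * conj c ^ q * linPart (α (k + 1) z).curryLeft (θ z j) v := by
      rw [linPart_eval, linPart_eval, smul_comm Complex.I c, curryLeft_type (ht _ z c hc),
        curryLeft_type (ht _ z c hc)]
      ring
    rw [linPart_smul, ContinuousAlternatingMap.smul_apply, smul_eq_mul] at h2
    apply mul_left_cancel₀ hc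
    rw [h2, zpow_sub_one₀ hc]
    field_simp
  · funext k z
    ext v
    rw [insertFrame_apply, pull, insertFrame_apply, θ_invariant]
    exact linPart_pull _ _ _ (fderiv_mul_smul g z) (curryLeft_pull (hg g) k z) _ v

theorem insertFrameBar_mem (j : Fin 3) {p q : ℤ} {α : Forms} (h : α ∈ invForms p q) :
    insertFrameBar j α ∈ invForms p (q - 1) := by
  obtain ⟨hs, ⟨hk, ht⟩, hg⟩ := mem_invForms.1 h
  refine mem_invForms.2 ⟨fun k => ?_, ⟨fun k h0 => ?_, fun k z c hc v => ?_⟩, fun g => ?_⟩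
  · simp only [funext (insertFrameBar_apply j α k)]
    exact (contDiff_antiPart (contDiff_curryLeft.comp (hs (k + 1)))).clm_apply (contDiff_θ j)
  · have : α (k + 1) = 0 := hk (k + 1) (by push_cast at h0 ⊢; omega)
    funext z
    ext v
    simp [insertFrameBar_apply, this, antiPart_eval]
  · rw [insertFrameBar_apply]
    have h2 : antiPart (α (k + 1) z).curryLeft (c • θ z j) (fun j => c • v j) =
        c ^ p * conj c ^ q * antiPart (α (k + 1) z).curryLeft (θ z j) v := by
      rw [antiPart_eval, antiPart_eval, smul_comm Complex.I c, curryLeft_type (ht _ z c hc),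
        curryLeft_type (ht _ z c hc)]
      ring
    have hc' : conj c ≠ 0 := (map_ne_zero _).2 hc
    rw [antiPart_smul, ContinuousAlternatingMap.smul_apply, smul_eq_mul] at h2
    apply mul_left_cancel₀ hc'
    rw [h2, zpow_sub_one₀ hc']
    field_simp
  · funext k z
    ext v
    rw [insertFrameBar_apply, pull, insertFrameBar_apply, θ_invariant]
    exact antiPart_pull _ _ _ (fderiv_mul_smul g z) (curryLeft_pull (hg g) k z) _ v

/-- A real linear map is the sum of its linear and its antilinear part, and each of these is
determined by its values on the complex basis `θ`. -/
theorem eq_sum_parts {F : Type*} [NormedAddCommGroup F] [NormedSpace ℝ F] [NormedSpace ℂ F]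
    [SMulCommClass ℝ ℂ F] [IsScalarTower ℝ ℂ F] (L : E →L[ℝ] F) (z u : E) :
    L u = ∑ j, φ z j u • linPart L (θ z j) + ∑ j, conj (φ z j u) • antiPart L (θ z j) := by
  simp only [← linPart_smul, ← antiPart_smul, ← map_sum, sum_φ_smul_θ]
  rw [linPart_apply, antiPart_apply]
  module

/-- The number operator. -/
theorem sum_wedge_insert (α : Forms) (k : ℕ) (z : E) :
    (∑ j, (wedge (coframe j) (insertFrame j α) + wedge (coframeBar j) (insertFrameBar j α))) k z =
      (k : ℂ) • α k z := by
  cases k with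
  | zero =>
    ext v
    simp [Finset.sum_apply, wedge_zero_apply]
  | succ k =>
    -- Currying and alternating again multiplies a form of degree `k + 1` by `k + 1`; expanding the
    -- curried form in the coframe turns this into the sum of the operators `e i`.
    have h := ContinuousAlternatingMap.alternatizeUncurryFin_curryLeft (α (k + 1) z)
    have h2 : (α (k + 1) z).curryLeft = ∑ j, (tens (coframe j z) (insertFrame j α k z) +
        tens (coframeBar j z) (insertFrameBar j α k z)) := by
      ext u : 1
      rw [eq_sum_parts (α (k + 1) z).curryLeft z u]
      simp [insertFrame_apply, insertFrameBar_apply, coframe_apply, coframeBar_apply,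
        Finset.sum_add_distrib]
    rw [h2, ← ContinuousAlternatingMap.alternatizeUncurryFinCLM_apply, map_sum] at h
    simp only [map_add] at h
    simp only [Finset.sum_apply, Pi.add_apply, wedge_succ_apply]
    refine h.trans ?_
    ext v
    simp

/-! ### Creation and annihilation operators -/

section Fock

variable {ι V : Type*} [AddCommGroup V] [Module ℂ V]

/-- The monomial in the creation operators `e a` for `a ∈ l` with `s a`, applied to the vacuum. -/
def monomial (e : ι → V →ₗ[ℂ] V) (vac : V) (l : List ι) (s : ι → Bool) : V :=
  l.foldr (fun a x => bif s a then e a x else x) vac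

variable {e i : ι → V →ₗ[ℂ] V} {vac : V}

theorem monomial_cons (a : ι) (l : List ι) (s : ι → Bool) :
    monomial e vac (a :: l) s = bif s a then e a (monomial e vac l s) else monomial e vac l s :=
  rfl

theorem monomial_congr {l : List ι} {s s' : ι → Bool} (h : ∀ a ∈ l, s a = s' a) :
    monomial e vac l s = monomial e vac l s' := by
  induction l with
  | nil => rfl
  | cons a l ih =>
    rw [monomial_cons, monomial_cons, h a (by simp), ih fun b hb => h b (by simp [hb])]

variable [DecidableEq ι]

/-- Creation operators `e`, annihilation operators `i` and a vacuum vector. -/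
structure IsCAR (e i : ι → V →ₗ[ℂ] V) (vac : V) : Prop where
  ee : ∀ a b x, e a (e b x) = -e b (e a x)
  ii : ∀ a b x, i a (i b x) = -i b (i a x)
  ie : ∀ a b x, i a (e b x) = (if a = b then x else 0) - e b (i a x)
  i_vac : ∀ a, i a vac = 0
  vac_ne : vac ≠ 0

/-- The sign that arises when `e a` is moved to its place in a monomial. -/
def moveSign (s : ι → Bool) (a : ι) : List ι → ℤ
  | [] => 1
  | b :: l => if a = b then 1 else (bif s b then -1 else 1) * moveSign s a l

namespace IsCAR

theorem ee_self (h : IsCAR e i vac) (a : ι) (x : V) : e a (e a x) = 0 := by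
  have h1 := h.ee a a x
  rw [eq_neg_iff_add_eq_zero, ← two_smul ℂ] at h1
  exact (smul_eq_zero.1 h1).resolve_left two_ne_zero

theorem i_monomial_of_notMem (h : IsCAR e i vac) {a : ι} {l : List ι} (ha : a ∉ l)
    (s : ι → Bool) : i a (monomial e vac l s) = 0 := by
  induction l with
  | nil => exact h.i_vac a
  | cons b l ih =>
    rw [List.mem_cons, not_or] at ha
    rw [monomial_cons]
    cases s b
    · exact ih ha.2
    · simp [h.ie, ha.1, ih ha.2]

/-- Anticommute `e a` to the right until it reaches the place of `a`; each factor that is passed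
costs a sign, and `e a` squares to zero if `a` is already occupied. The toggled set `s'` is
described by its values, so that it can be read off from binary digits. -/
theorem e_monomial (h : IsCAR e i vac) {a : ι} {l : List ι} (hl : l.Nodup) (ha : a ∈ l)
    {s s' : ι → Bool} (h1 : s' a = !s a) (h2 : ∀ b, b ≠ a → s' b = s b) :
    e a (monomial e vac l s) =
      if s a then 0 else (moveSign s a l : ℂ) • monomial e vac l s' := by
  induction l with
  | nil => simp at ha
  | cons b l ih =>
    rw [List.nodup_cons] at hl
    rw [monomial_cons, monomial_cons]
    by_cases hab : a = b
    · subst hab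
      have h3 : monomial e vac l s' = monomial e vac l s :=
        monomial_congr fun b hb => h2 b (by rintro rfl; exact hl.1 hb)
      rw [h1, h3]
      cases s a <;> simp [moveSign, h.ee_self]
    · have ih := ih hl.2 ((List.mem_cons.1 ha).resolve_left hab)
      rw [h2 b (Ne.symm hab)]
      cases hb : s b
      · simp [ih, moveSign, hab, hb]
      · rw [cond_true, h.ee, ih]
        cases s a <;> simp [moveSign, hab, hb]

theorem i_monomial (h : IsCAR e i vac) {a : ι} {l : List ι} (hl : l.Nodup) (ha : a ∈ l)
    {s s' : ι → Bool} (h1 : s' a = !s a) (h2 : ∀ b, b ≠ a → s' b = s b) :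
    i a (monomial e vac l s) =
      if s a then (moveSign s a l : ℂ) • monomial e vac l s' else 0 := by
  induction l with
  | nil => simp at ha
  | cons b l ih =>
    rw [List.nodup_cons] at hl
    rw [monomial_cons, monomial_cons]
    by_cases hab : a = b
    · subst hab
      have h3 : monomial e vac l s' = monomial e vac l s :=
        monomial_congr fun b hb => h2 b (by rintro rfl; exact hl.1 hb)
      rw [h1, h3]
      cases s a <;> simp [moveSign, h.i_monomial_of_notMem hl.1, h.ie]
    · have ih := ih hl.2 ((List.mem_cons.1 ha).resolve_left hab)
      rw [h2 b (Ne.symm hab)]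
      cases hb : s b
      · simp [ih, moveSign, hab, hb]
      · rw [cond_true, h.ie, if_neg hab, ih]
        cases s a <;> simp [moveSign, hab, hb]

/-- The operator `e a ∘ i a` is the occupation number of `a`. The signs of the two passages cancel.
-/
theorem ei_monomial (h : IsCAR e i vac) {a : ι} {l : List ι} (hl : l.Nodup) (ha : a ∈ l)
    (s : ι → Bool) :
    e a (i a (monomial e vac l s)) = (if s a then (1 : ℂ) else 0) • monomial e vac l s := by
  induction l with
  | nil => simp at ha
  | cons b l ih =>
    rw [List.nodup_cons] at hl
    rw [monomial_cons]
    by_cases hab : a = b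
    · subst hab
      cases s a <;> simp [h.i_monomial_of_notMem hl.1, h.ie]
    · have ih := ih hl.2 ((List.mem_cons.1 ha).resolve_left hab)
      cases s b
      · simp [ih]
      · rw [cond_true, h.ie, if_neg hab, zero_sub, map_neg, h.ee, neg_neg, ih, map_smul]

/-- Annihilating the first factor recovers the shorter monomial, and so on down to the vacuum. -/
theorem monomial_ne_zero (h : IsCAR e i vac) {l : List ι} (hl : l.Nodup) (s : ι → Bool) :
    monomial e vac l s ≠ 0 := by
  induction l with
  | nil => exact h.vac_ne
  | cons b l ih =>
    rw [List.nodup_cons] at hl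
    rw [monomial_cons]
    cases s b
    · exact ih hl.2
    · intro h0
      have h1 := congrArg (i b) h0
      rw [cond_true, h.ie, h.i_monomial_of_notMem hl.1] at h1
      exact ih hl.2 (by simpa using h1)

/-- Change of frame: creation operators transform with `M`, annihilation operators with the
inverse transpose `N`. -/
theorem change [Fintype ι] (h : IsCAR e i vac) {M N : Matrix ι ι ℂ} (hMN : N * M.transpose = 1) :
    IsCAR (fun a => ∑ b, M a b • e b) (fun a => ∑ b, N a b • i b) vac where
  ee a b x := by
    simp only [LinearMap.sum_apply, LinearMap.smul_apply, map_sum, map_smul]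
    rw [Finset.sum_congr rfl fun c _ => Finset.smul_sum, Finset.sum_comm, ← Finset.sum_neg_distrib]
    refine Finset.sum_congr rfl fun c _ => ?_
    rw [Finset.smul_sum, ← Finset.sum_neg_distrib]
    refine Finset.sum_congr rfl fun d _ => ?_
    rw [h.ee, smul_neg, smul_neg, smul_comm]
  ii a b x := by
    simp only [LinearMap.sum_apply, LinearMap.smul_apply, map_sum, map_smul]
    rw [Finset.sum_congr rfl fun c _ => Finset.smul_sum, Finset.sum_comm, ← Finset.sum_neg_distrib]
    refine Finset.sum_congr rfl fun c _ => ?_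
    rw [Finset.smul_sum, ← Finset.sum_neg_distrib]
    refine Finset.sum_congr rfl fun d _ => ?_
    rw [h.ii, smul_neg, smul_neg, smul_comm]
  ie a b x := by
    have h1 : (if a = b then x else 0) = ∑ c, (N a c * M b c) • x := by
      rw [← Finset.sum_smul]
      have := congrFun (congrFun hMN a) b
      simp only [Matrix.mul_apply, Matrix.transpose_apply, Matrix.one_apply] at this
      rw [this]
      split_ifs <;> simp
    rw [h1]
    simp only [LinearMap.sum_apply, LinearMap.smul_apply, map_sum, map_smul, h.ie, smul_sub,
      Finset.sum_sub_distrib, smul_ite, smul_zero, Finset.smul_sum, smul_smul]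
    congr 1
    · refine Finset.sum_congr rfl fun c _ => ?_
      simp [mul_comm]
    · rw [Finset.sum_comm]
      refine Finset.sum_congr rfl fun c _ => Finset.sum_congr rfl fun d _ => ?_
      rw [mul_comm]
  i_vac a := by simp [h.i_vac]
  vac_ne := h.vac_ne

end IsCAR

/-- The total number operator does not depend on the frame, because a right inverse of a square
matrix is also a left inverse: `Mᵀ N = 1`. -/
theorem sum_change [Fintype ι] (e i : ι → V →ₗ[ℂ] V) {M N : Matrix ι ι ℂ}
    (hMN : N * M.transpose = 1) (x : V) :
    ∑ a, (∑ b, M a b • e b) ((∑ b, N a b • i b) x) = ∑ a, e a (i a x) := by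
  have h1 : ∀ b c, ∑ a, M a b * N a c = if b = c then 1 else 0 := by
    intro b c
    have h2 : M.transpose * N = 1 := mul_eq_one_comm.1 hMN
    have := congrFun (congrFun h2 b) c
    simpa [Matrix.mul_apply, Matrix.one_apply] using this
  simp only [LinearMap.sum_apply, LinearMap.smul_apply, map_sum, map_smul, Finset.smul_sum,
    smul_smul]
  have h2 : ∀ b, ∑ c, ∑ a, (M a b * N a c) • e b (i c x) = e b (i b x) := by
    intro b
    rw [Finset.sum_congr rfl fun c _ => (Finset.sum_smul (R := ℂ)).symm]
    simp [h1]
  rw [← Finset.sum_congr rfl fun b _ => h2 b, Finset.sum_comm]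
  conv_rhs => rw [Finset.sum_comm]
  refine Finset.sum_congr rfl fun c _ => ?_
  rw [Finset.sum_comm]
  refine Finset.sum_congr rfl fun b _ => Finset.sum_congr rfl fun a _ => ?_
  rw [mul_comm]

end Fock

/-! ### The standard frame -/

/-- The indices of the six creation operators: `inl` for forms of type `(1,0)`, `inr` for
forms of type `(0,1)`. -/
abbrev Mode : Type := Fin 3 ⊕ Fin 3

/-- Exterior multiplication by `φʲ` and `φ̄ʲ`. -/
def stdE : Mode → Forms →ₗ[ℂ] Forms :=
  Sum.elim (fun j => wedge (coframe j)) (fun j => wedge (coframeBar j))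

/-- Insertion of `θⱼ` and `θ̄ⱼ`. -/
def stdI : Mode → Forms →ₗ[ℂ] Forms := Sum.elim insertFrame insertFrameBar

/-- The constant function `1`. -/
def vac : Forms
  | 0 => fun _ => ContinuousAlternatingMap.constOfIsEmpty ℝ E (Fin 0) 1
  | _ + 1 => 0

theorem vac_mem : vac ∈ invForms 0 0 := by
  refine mem_invForms.2 ⟨fun k => ?_, ⟨fun k h0 => ?_, fun k z c _ v => ?_⟩, fun g => ?_⟩
  · cases k <;> exact contDiff_const
  · cases k with
    | zero => simp at h0
    | succ k => rfl
  · cases k <;> simp [vac]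
  · funext k z
    ext v
    cases k <;> simp [vac, pull]

/-- The mixed relation reduces to the pairing of the coframe with the frame. The halves in
`insertFrame` and `insertFrameBar` add up to 1 for vectors and covectors of the same type and cancel
for opposite types. -/
theorem stdE_isCAR : IsCAR stdE stdI vac where
  ee a b x := by
    cases a <;> cases b <;> exact wedge_wedge _ _ _
  ii a b x := by
    cases a <;> cases b <;> exact insertion_insertion _ _ _ _ _
  ie a b x := by
    have key : ∀ (X Y : E → E) (f : E → E →L[ℝ] ℂ) (p : Prop) [Decidable p],
        (∀ z, f z (X z) + Complex.I * f z (Y z) = if p then 1 else 0) →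
        insertion X Y (wedge f x) = (if p then x else 0) - wedge f (insertion X Y x) := by
      intro X Y f p _ h
      rw [insertion_wedge X Y f _ h]
      split_ifs
      · exact congrArg (· - _) (one_smul ℂ x)
      · exact congrArg (· - _) (zero_smul ℂ x)
    have hI : Complex.I * Complex.I = -1 := Complex.I_mul_I
    rcases a with a | a <;> rcases b with b | b <;> refine key _ _ _ _ fun z => ?_
    · simp only [coframe_apply, φ_smul, φ_θ, Sum.inl.injEq, eq_comm (a := b)]
      split_ifs
      · linear_combination (-1 / 2 : ℂ) * hI
      · ring
    · simp only [coframeBar_apply, φ_smul, φ_θ, eq_comm (a := b), map_mul, reduceCtorEq, if_false]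
      split_ifs
      · simp [Complex.conj_ofNat]
        linear_combination (1 / 2 : ℂ) * hI
      · simp
    · simp only [coframe_apply, φ_smul, φ_θ, eq_comm (a := b), reduceCtorEq, if_false]
      split_ifs
      · linear_combination (1 / 2 : ℂ) * hI
      · ring
    · simp only [coframeBar_apply, φ_smul, φ_θ, eq_comm (a := b), map_mul, Sum.inr.injEq]
      split_ifs
      · simp [Complex.conj_ofNat]
        linear_combination (-1 / 2 : ℂ) * hI
      · simp
  i_vac a := by
    cases a <;> (ext k z v; exact (insertion_apply _ _ _ _ _ _).trans (by simp [vac]))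
  vac_ne h := by
    have := congrArg (fun α : Forms => α 0 0 ![]) h
    simp [vac] at this

theorem sum_stdE_stdI {p q : ℤ} {α : Forms} (h : α ∈ invForms p q) :
    ∑ a, stdE a (stdI a α) = ((p + q : ℤ) : ℂ) • α := by
  funext k z
  have h1 := sum_wedge_insert α k z
  rw [Finset.sum_add_distrib] at h1
  rw [Fintype.sum_sum_type]
  refine h1.trans ?_
  by_cases hk : (k : ℤ) = p + q
  · rw [← hk]
    simp
  · rw [Pi.smul_apply, Pi.smul_apply, (mem_invForms.1 h).2.1.1 k hk, Pi.zero_apply]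
    ext v
    simp

/-! ### The differentials on left invariant forms -/

/-- The nilpotent endomorphism `θ₂ ↦ θ₃` at the origin. -/
def shear : E →L[ℝ] E :=
  LinearMap.toContinuousLinearMap
    { toFun := fun u => ![0, 0, u 1]
      map_add' := by
        intro u v
        ext j
        fin_cases j <;> simp
      map_smul' := by
        intro r u
        ext j
        fin_cases j <;> simp }

/-- The differential of `shear`-translations, linear in the base point. -/
def shearFamily : E →L[ℝ] E →L[ℝ] E :=
  ((ContinuousLinearMap.toSpanSingleton ℂ shear).restrictScalars ℝ) ∘L
    ContinuousLinearMap.proj (R := ℝ) 0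

theorem shearFamily_apply (h u : E) : shearFamily h u = (h 0 * u 1) • θ 0 2 := by
  ext j
  fin_cases j <;> simp [shearFamily, shear, θ]

/-- Translate `z` back to the origin. The differential of the left translation with `z` is `1 +
shearFamily z`, with inverse `1 - shearFamily z` because the shear squares to zero. The dependence
on the base point thus comes from a linear family, which makes derivatives at the origin computable.
-/
theorem invariant_eq {α : Forms} (hα : ∀ g, pull g α = α) (k : ℕ) (z : E) :
    α k z = (α k 0).compContinuousLinearMap (ContinuousLinearMap.id ℝ E - shearFamily z) := by
  conv_rhs => rw [← hα z]
  have h1 : mul z 0 = z := by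
    ext j
    fin_cases j <;> simp [mul]
  ext v
  simp only [pull, ContinuousAlternatingMap.compContinuousLinearMap_apply, h1]
  congr 1
  funext j
  simp only [Function.comp_apply, fderiv_mul]
  ext i
  fin_cases i <;> simp [shearFamily_apply, θ]

theorem eq_of_eq_at_zero {α β : Forms} (hα : ∀ g, pull g α = α) (hβ : ∀ g, pull g β = β)
    (h : ∀ k, α k 0 = β k 0) : α = β := by
  funext k z
  rw [invariant_eq hα, invariant_eq hβ, h]

/-- By the Leibniz rule the derivative acts on `α k 0` through the derivation induced by
`-shearFamily u`. This shear sends `w` to `u⁰ w¹ θ³`, so the derivation is `φ² ∧ (θ₃ ⌟ ·)` with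
coefficient `u⁰`, plus the conjugate term. -/
theorem fderiv_invariant {α : Forms} (hα : ∀ g, pull g α = α) (k : ℕ) (u : E) :
    fderiv ℝ (α k) 0 u =
      -(u 0 • stdE (.inl 1) (stdI (.inl 2) α) k 0 +
        conj (u 0) • stdE (.inr 1) (stdI (.inr 2) α) k 0) := by
  have h1 : HasFDerivAt (fun z : E => ContinuousLinearMap.id ℝ E - shearFamily z)
      (-shearFamily) 0 := shearFamily.hasFDerivAt.const_sub _
  have h2 := (hasFDerivAt_const (α k 0) (0 : E)).continuousAlternatingMapCompContinuousLinearMap h1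
  rw [← funext (invariant_eq hα k)] at h2
  rw [h2.fderiv]
  cases k with
  | zero =>
    ext v
    simp [stdE, wedge_zero_apply]
  | succ k =>
    have h3 : (α (k + 1) 0).curryLeft ∘L shearFamily u =
        u 0 • tens (coframe 1 0) (insertFrame 2 α k 0) +
          conj (u 0) • tens (coframeBar 1 0) (insertFrameBar 2 α k 0) := by
      ext w : 1
      rw [ContinuousLinearMap.comp_apply, shearFamily_apply,
        eq_sum_parts (α (k + 1) 0).curryLeft 0]
      have h6 : φ 0 1 w = w 1 := rfl
      simp [φ_smul, φ_θ, insertFrame_apply, insertFrameBar_apply, coframe_apply, coframeBar_apply,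
        smul_smul, h6, apply_ite conj, ite_smul]
    have h4 : (α (k + 1) 0).fderivCompContinuousLinearMap (ContinuousLinearMap.id ℝ E)
        (shearFamily u) = ContinuousAlternatingMap.alternatizeUncurryFin
          ((α (k + 1) 0).curryLeft ∘L shearFamily u) := by
      rw [ContinuousAlternatingMap.fderivCompContinuousLinearMap_eq_alternatizeUncurryFin]
      ext v
      simp [ContinuousAlternatingMap.alternatizeUncurryFin_apply]
    have h5 : ContinuousLinearMap.id ℝ E - shearFamily 0 = ContinuousLinearMap.id ℝ E := by
      simp
    rw [h5]
    simp only [add_apply, ContinuousLinearMap.comp_apply,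
      zero_apply, neg_apply, map_neg, map_zero, zero_add,
      h4, h3, ContinuousAlternatingMap.alternatizeUncurryFin_add,
      ContinuousAlternatingMap.alternatizeUncurryFin_smul]
    rfl

/-- Both sides are left invariant, so it suffices to compare them at the origin. There the linear
part of the derivative keeps the term with `u⁰` and drops the one with its conjugate. -/
theorem del_invariant {p q : ℤ} {α : Forms} (h : α ∈ invForms p q) :
    del α = -stdE (.inl 0) (stdE (.inl 1) (stdI (.inl 2) α)) := by
  have hm := neg_mem (wedge_coframe_mem 0 (wedge_coframe_mem 1 (insertFrame_mem 2 h)))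
  refine eq_of_eq_at_zero (mem_invForms.1 (del_mem h)).2.2 (mem_invForms.1 hm).2.2 fun k => ?_
  cases k with
  | zero => ext v; simp [del, stdE, wedge_zero_apply]
  | succ k =>
    have h1 : linPart (fderiv ℝ (α k) 0) =
        -tens (coframe 0 0) (wedge (coframe 1) (insertFrame 2 α) k 0) := by
      ext u v
      rw [linPart_eval, fderiv_invariant (mem_invForms.1 h).2.2,
        fderiv_invariant (mem_invForms.1 h).2.2]
      simp [coframe_apply, φ, stdE, stdI]
      linear_combination (1 / 2 : ℂ) * (u 0 * wedge (coframe 1) (insertFrame 2 α) k 0 v -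
        conj (u 0) * wedge (coframeBar 1) (insertFrameBar 2 α) k 0 v) * Complex.I_mul_I
    change ContinuousAlternatingMap.alternatizeUncurryFin (linPart (fderiv ℝ (α k) 0)) = _
    rw [h1, ← ContinuousAlternatingMap.alternatizeUncurryFinCLM_apply, map_neg]
    rfl

theorem delbar_invariant {p q : ℤ} {α : Forms} (h : α ∈ invForms p q) :
    delbar α = -stdE (.inr 0) (stdE (.inr 1) (stdI (.inr 2) α)) := by
  have hm := neg_mem (wedge_coframeBar_mem 0 (wedge_coframeBar_mem 1 (insertFrameBar_mem 2 h)))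
  refine eq_of_eq_at_zero (mem_invForms.1 (delbar_mem h)).2.2 (mem_invForms.1 hm).2.2 fun k => ?_
  cases k with
  | zero => ext v; simp [delbar, stdE, wedge_zero_apply]
  | succ k =>
    have h1 : antiPart (fderiv ℝ (α k) 0) =
        -tens (coframeBar 0 0) (wedge (coframeBar 1) (insertFrameBar 2 α) k 0) := by
      ext u v
      rw [antiPart_eval, fderiv_invariant (mem_invForms.1 h).2.2,
        fderiv_invariant (mem_invForms.1 h).2.2]
      simp [coframeBar_apply, φ, stdE, stdI]
      linear_combination (1 / 2 : ℂ) * (-u 0 * wedge (coframe 1) (insertFrame 2 α) k 0 v +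
        conj (u 0) * wedge (coframeBar 1) (insertFrameBar 2 α) k 0 v) * Complex.I_mul_I
    change ContinuousAlternatingMap.alternatizeUncurryFin (antiPart (fderiv ℝ (α k) 0)) = _
    rw [h1, ← ContinuousAlternatingMap.alternatizeUncurryFinCLM_apply, map_neg]
    rfl

theorem contract_beltrami (t : Param) (α : Forms) :
    contract (beltrami t) α =
      ∑ i : Fin 3, ∑ l : Fin 2, t i l • stdE (.inr l.castSucc) (stdI (.inl i) α) -
        D t • stdE (.inr 2) (stdI (.inl 2) α) := by
  funext k z
  cases k with
  | zero =>
    ext v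
    simp [contract, stdE, wedge_zero_apply, Finset.sum_apply]
  | succ k =>
    have h1 : linPart (α (k + 1) z).curryLeft ∘L beltrami t z =
        ∑ i : Fin 3, ∑ l : Fin 2, t i l • tens (coframeBar l.castSucc z) (insertFrame i α k z) -
          D t • tens (coframeBar 2 z) (insertFrame 2 α k z) := by
      ext u : 1
      rw [ContinuousLinearMap.comp_apply, beltrami_apply]
      simp [insertFrame_apply, linPart_smul, coframeBar_apply, smul_smul, Fin.sum_univ_succ]
    change ContinuousAlternatingMap.alternatizeUncurryFin
      (linPart (α (k + 1) z).curryLeft ∘L beltrami t z) = _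
    rw [h1]
    simp only [Fin.sum_univ_three, Fin.sum_univ_two,
      ← ContinuousAlternatingMap.alternatizeUncurryFinCLM_apply, map_sub, map_add]
    simp only [ContinuousAlternatingMap.alternatizeUncurryFinCLM_apply,
      ContinuousAlternatingMap.alternatizeUncurryFin_smul]
    rfl

/-! ### Bigraded Fock spaces -/

/-- The six indices in the order of the factors of a monomial. -/
def modes : List Mode := [.inl 0, .inl 1, .inl 2, .inr 0, .inr 1, .inr 2]

/-- The binary digit that belongs to an index. -/
def digit : Mode → ℕ := Sum.elim (fun j => j) (fun j => 3 + j)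

/-- The set of indices that is encoded in the binary digits of `n`. -/
def bits (n : ℕ) (a : Mode) : Bool := n.testBit (digit a)

/-- The type `(p, q)` of a monomial. -/
def bidegree (l : List Mode) (s : Mode → Bool) : ℤ × ℤ :=
  (l.countP fun a => a.isLeft && s a, l.countP fun a => a.isRight && s a)

/-- The type `(p, q)` of the monomial number `n`. -/
def bideg (n : ℕ) : ℤ × ℤ := bidegree modes (bits n)

theorem modes_nodup : modes.Nodup := by decide

theorem mem_modes (a : Mode) : a ∈ modes := by
  rcases a with a | a <;> fin_cases a <;> simp [modes]

theorem digit_lt (a : Mode) : digit a < 6 := by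
  rcases a with a | a <;> simp [digit] <;> omega

theorem digit_injective : Function.Injective digit := by
  rintro (a | a) (b | b) h <;> simp [digit, Fin.ext_iff] at h ⊢ <;> omega

/-- Toggle the digit of `a`. -/
def toggle (n : ℕ) (a : Mode) : ℕ := n ^^^ 2 ^ digit a

theorem bits_toggle_self (n : ℕ) (a : Mode) : bits (toggle n a) a = !bits n a := by
  simp [bits, toggle, Nat.testBit_xor]

theorem bits_toggle_of_ne (n : ℕ) (a b : Mode) (h : b ≠ a) : bits (toggle n a) b = bits n b := by
  simp [bits, toggle, Nat.testBit_xor, Nat.testBit_two_pow_of_ne (digit_injective.ne h.symm)]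

theorem bideg_toggle : ∀ a : Mode, ∀ n : Fin 64, bits n a = false → toggle n a < 64 ∧
    bideg (toggle n a) = bideg n + if a.isLeft then (1, 0) else (0, 1) := by
  decide +kernel

/-- The weighted occupation numbers add up to the number of the monomial; in
`IsFock.linearIndependent` this separates the eigenvalues. -/
theorem sum_digits : ∀ n : Fin 64, (∑ a : Mode, if bits n a then 2 ^ digit a else 0) = (n : ℕ) := by
  decide +kernel

section

variable {V : Type*} [AddCommGroup V] [Module ℂ V]

/-- The monomial number `n` in the creation operators. -/
def mono (e : Mode → V →ₗ[ℂ] V) (vac : V) (n : ℕ) : V := monomial e vac modes (bits n)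

/-- A bigraded family of subspaces with creation and annihilation operators of bidegrees
`(±1, 0)` and `(0, ±1)`, which is generated by the vacuum. -/
structure IsFock (e i : Mode → V →ₗ[ℂ] V) (vac : V) (S : ℤ → ℤ → Submodule ℂ V) : Prop where
  car : IsCAR e i vac
  e_inl : ∀ (j : Fin 3) (p q : ℤ), ∀ x ∈ S p q, e (.inl j) x ∈ S (p + 1) q
  e_inr : ∀ (j : Fin 3) (p q : ℤ), ∀ x ∈ S p q, e (.inr j) x ∈ S p (q + 1)
  i_inl : ∀ (j : Fin 3) (p q : ℤ), ∀ x ∈ S p q, i (.inl j) x ∈ S (p - 1) q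
  i_inr : ∀ (j : Fin 3) (p q : ℤ), ∀ x ∈ S p q, i (.inr j) x ∈ S p (q - 1)
  number : ∀ p q : ℤ, ∀ x ∈ S p q, ∑ a, e a (i a x) = ((p + q : ℤ) : ℂ) • x
  vac_mem : vac ∈ S 0 0
  le_span : S 0 0 ≤ Submodule.span ℂ {vac}
  eq_bot : ∀ p q : ℤ, p + q ≤ 0 → ¬(p = 0 ∧ q = 0) → S p q = ⊥

namespace IsFock

variable {e i : Mode → V →ₗ[ℂ] V} {vac : V} {S : ℤ → ℤ → Submodule ℂ V}

theorem e_mono (h : IsFock e i vac S) (a : Mode) (n : ℕ) : e a (mono e vac n) =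
    if bits n a then 0 else (moveSign (bits n) a modes : ℂ) • mono e vac (toggle n a) :=
  h.car.e_monomial modes_nodup (mem_modes a) (bits_toggle_self n a)
    fun b hb => bits_toggle_of_ne n a b hb

theorem i_mono (h : IsFock e i vac S) (a : Mode) (n : ℕ) : i a (mono e vac n) =
    if bits n a then (moveSign (bits n) a modes : ℂ) • mono e vac (toggle n a) else 0 :=
  h.car.i_monomial modes_nodup (mem_modes a) (bits_toggle_self n a)
    fun b hb => bits_toggle_of_ne n a b hb

/-- Monomial number `n` is an eigenvector of `∑ 2 ^ digit a • e a ∘ i a` with eigenvalue `n`, and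
these eigenvalues are distinct. -/
theorem linearIndependent (h : IsFock e i vac S) :
    LinearIndependent ℂ fun n : Fin 64 => mono e vac n := by
  refine Module.End.eigenvectors_linearIndependent'
    (∑ a : Mode, (2 : ℂ) ^ digit a • (e a ∘ₗ i a)) (fun n : Fin 64 => ((n : ℕ) : ℂ))
    (fun m n hmn => Fin.ext (Nat.cast_injective hmn)) _ fun n => ?_
  refine Module.End.hasEigenvector_iff.2
    ⟨Module.End.mem_eigenspace_iff.2 ?_, h.car.monomial_ne_zero modes_nodup _⟩
  have h1 := congrArg (fun m : ℕ => (m : ℂ)) (sum_digits n)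
  simp only [Nat.cast_sum] at h1
  rw [← h1, Finset.sum_smul, LinearMap.sum_apply]
  refine Finset.sum_congr rfl fun a _ => ?_
  rw [LinearMap.smul_apply, LinearMap.comp_apply, mono,
    h.car.ei_monomial modes_nodup (mem_modes a)]
  cases bits n a <;> simp

theorem monomial_mem (h : IsFock e i vac S) (l : List Mode) (s : Mode → Bool) :
    monomial e vac l s ∈ S (bidegree l s).1 (bidegree l s).2 := by
  induction l with
  | nil => exact h.vac_mem
  | cons a l ih =>
    rw [monomial_cons]
    cases hs : s a
    · rcases a with a | a <;> simpa [bidegree, hs] using ih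
    · rcases a with a | a
      · simpa [bidegree, hs] using h.e_inl a _ _ _ ih
      · simpa [bidegree, hs] using h.e_inr a _ _ _ ih

theorem mono_mem (h : IsFock e i vac S) (n : ℕ) : mono e vac n ∈ S (bideg n).1 (bideg n).2 :=
  h.monomial_mem _ _

/-- The span of the monomials of type `(p, q)`. -/
def monoSpan (e : Mode → V →ₗ[ℂ] V) (vac : V) (x : ℤ × ℤ) : Submodule ℂ V :=
  Submodule.span ℂ {w | ∃ n : Fin 64, bideg n = x ∧ w = mono e vac n}

theorem e_monoSpan (h : IsFock e i vac S) (a : Mode) {x : ℤ × ℤ} {w : V}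
    (hw : w ∈ monoSpan e vac x) :
    e a w ∈ monoSpan e vac (x + if a.isLeft then (1, 0) else (0, 1)) := by
  induction hw using Submodule.span_induction with
  | mem w hw =>
    obtain ⟨n, hn, rfl⟩ := hw
    rw [h.e_mono]
    cases hb : bits n a
    · obtain ⟨h1, h2⟩ := bideg_toggle a n hb
      rw [if_neg Bool.false_ne_true]
      exact Submodule.smul_mem _ _ (Submodule.subset_span ⟨⟨_, h1⟩, by rw [h2, hn], rfl⟩)
    · exact zero_mem _
  | zero => simp
  | add x y _ _ hx hy => rw [map_add]; exact add_mem hx hy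
  | smul c x _ hx => rw [map_smul]; exact Submodule.smul_mem _ _ hx

/-- Induction on the total degree: the number operator gives `(p + q) x = ∑ e a (i a x)`, where
every `i a x` has lower degree. Division by `p + q` is possible in positive degree; the other
degrees are covered by `le_span` and `eq_bot`. -/
theorem le_monoSpan (h : IsFock e i vac S) (p q : ℤ) : S p q ≤ monoSpan e vac (p, q) := by
  by_cases hpq : p + q ≤ 0
  · by_cases h0 : p = 0 ∧ q = 0
    · obtain ⟨rfl, rfl⟩ := h0
      refine h.le_span.trans (Submodule.span_le.2 ?_)
      rintro _ rfl
      exact Submodule.subset_span ⟨0, by decide, by simp [mono, monomial, modes, bits]⟩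
    · simp [h.eq_bot p q hpq h0]
  · obtain ⟨k, hk⟩ : ∃ k : ℕ, p + q = k + 1 := ⟨(p + q - 1).toNat, by omega⟩
    clear hpq
    induction k using Nat.strong_induction_on generalizing p q with
    | _ k ih =>
      have ih' : ∀ p q : ℤ, p + q = k → S p q ≤ monoSpan e vac (p, q) := by
        intro p q hpq
        cases k with
        | zero =>
          by_cases h0 : p = 0 ∧ q = 0
          · obtain ⟨rfl, rfl⟩ := h0
            refine h.le_span.trans (Submodule.span_le.2 ?_)
            rintro _ rfl
            exact Submodule.subset_span ⟨0, by decide, by simp [mono, monomial, modes, bits]⟩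
          · simp [h.eq_bot p q (by simp [hpq]) h0]
        | succ k => exact ih k (by omega) p q (by simpa using hpq)
      intro x hx
      have h1 : ∑ a, e a (i a x) ∈ monoSpan e vac (p, q) := by
        refine sum_mem fun a _ => ?_
        rcases a with a | a
        · simpa using h.e_monoSpan (.inl a) (ih' (p - 1) q (by omega) (h.i_inl a p q x hx))
        · simpa using h.e_monoSpan (.inr a) (ih' p (q - 1) (by omega) (h.i_inr a p q x hx))
      rw [h.number p q x hx] at h1
      have h2 : ((p + q : ℤ) : ℂ) ≠ 0 := by
        rw [hk]
        exact_mod_cast (by omega : ((k : ℤ) + 1) ≠ 0)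
      have h3 := Submodule.smul_mem _ ((p + q : ℤ) : ℂ)⁻¹ h1
      rwa [smul_smul, inv_mul_cancel₀ h2, one_smul] at h3

/-- Block diagonal changes of frame do not mix the two types, so bidegrees are preserved; the vacuum
and the number operator are unchanged. -/
theorem change (h : IsFock e i vac S) {P P' R R' : Matrix (Fin 3) (Fin 3) ℂ}
    (hP : P' * P.transpose = 1) (hR : R' * R.transpose = 1) :
    IsFock (Sum.elim (fun a => ∑ b, P a b • e (.inl b)) (fun a => ∑ b, R a b • e (.inr b)))
      (Sum.elim (fun a => ∑ b, P' a b • i (.inl b)) (fun a => ∑ b, R' a b • i (.inr b))) vac S := by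
  have h0 : Matrix.fromBlocks P' 0 0 R' * (Matrix.fromBlocks P 0 0 R).transpose = 1 := by
    simp [Matrix.fromBlocks_transpose, Matrix.fromBlocks_multiply, hP, hR]
  have h1 : ∀ (A B : Matrix (Fin 3) (Fin 3) ℂ) (f : Mode → V →ₗ[ℂ] V),
      Sum.elim (fun a => ∑ b, A a b • f (.inl b)) (fun a => ∑ b, B a b • f (.inr b)) =
        fun a => ∑ b, Matrix.fromBlocks A 0 0 B a b • f b := by
    intro A B f
    funext a
    rcases a with a | a <;> simp [Fintype.sum_sum_type]
  refine ⟨?_, ?_, ?_, ?_, ?_, ?_, h.vac_mem, h.le_span, h.eq_bot⟩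
  · rw [h1, h1]
    exact h.car.change h0
  · intro j p q x hx
    simp only [Sum.elim_inl, LinearMap.sum_apply]
    exact sum_mem fun b _ => Submodule.smul_mem _ _ (h.e_inl b p q x hx)
  · intro j p q x hx
    simp only [Sum.elim_inr, LinearMap.sum_apply]
    exact sum_mem fun b _ => Submodule.smul_mem _ _ (h.e_inr b p q x hx)
  · intro j p q x hx
    simp only [Sum.elim_inl, LinearMap.sum_apply]
    exact sum_mem fun b _ => Submodule.smul_mem _ _ (h.i_inl b p q x hx)
  · intro j p q x hx
    simp only [Sum.elim_inr, LinearMap.sum_apply]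
    exact sum_mem fun b _ => Submodule.smul_mem _ _ (h.i_inr b p q x hx)
  · intro p q x hx
    rw [h1, h1, ← h.number p q x hx]
    exact sum_change e i h0 x

end IsFock

end

/-! ### Computations with monomials -/

/-- Integer combinations of monomials, as lists of coefficients and monomial numbers. -/
abbrev Vec : Type := List (ℤ × ℕ)

namespace Vec

/-- The coefficient of the monomial number `n`. -/
def coeff (v : Vec) (n : ℕ) : ℤ := (v.map fun c => if c.2 % 64 = n then c.1 else 0).sum

/-- Equality of all coefficients. -/
def Equiv (v w : Vec) : Prop := ∀ n ∈ List.range 64, coeff v n = coeff w n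

instance (v w : Vec) : Decidable (Equiv v w) := inferInstanceAs (Decidable (∀ n ∈ _, _))

/-- Scalar multiplication. -/
def scale (c : ℤ) (v : Vec) : Vec := v.map fun d => (c * d.1, d.2)

/-- The creation operator. -/
def create (a : Mode) (v : Vec) : Vec :=
  v.flatMap fun c =>
    if bits c.2 a then [] else [(moveSign (bits c.2) a modes * c.1, toggle c.2 a)]

/-- The annihilation operator. -/
def annihilate (a : Mode) (v : Vec) : Vec :=
  v.flatMap fun c =>
    if bits c.2 a then [(moveSign (bits c.2) a modes * c.1, toggle c.2 a)] else []

end Vec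

/-- Linear combinations of operators `e a ∘ e b ∘ i c`, as lists of the coefficients and the
indices `(a, b, c)`. -/
abbrev Cubic : Type := List (ℤ × Mode × Mode × Mode)

/-- The action on combinations of monomials. -/
def Cubic.act (T : Cubic) (v : Vec) : Vec :=
  T.flatMap fun c =>
    Vec.scale c.1 (Vec.create c.2.1 (Vec.create c.2.2.1 (Vec.annihilate c.2.2.2 v)))

section

variable {V : Type*} [AddCommGroup V] [Module ℂ V]

/-- The operator that corresponds to a list. -/
def Cubic.op (e i : Mode → V →ₗ[ℂ] V) (T : Cubic) : V →ₗ[ℂ] V :=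
  (T.map fun c => (c.1 : ℂ) • (e c.2.1 ∘ₗ e c.2.2.1 ∘ₗ i c.2.2.2)).sum

/-- The combination of monomials that corresponds to a list. -/
def Vec.eval (e : Mode → V →ₗ[ℂ] V) (vac : V) (v : Vec) : V :=
  (v.map fun c => (c.1 : ℂ) • mono e vac c.2).sum

namespace Vec

variable {e i : Mode → V →ₗ[ℂ] V} {vac : V} {S : ℤ → ℤ → Submodule ℂ V}

/-- Only the six lowest binary digits enter a monomial. Hence the reduction modulo 64 in `coeff`
loses nothing, and no bound on the entries of a `Vec` has to be carried along. -/
theorem mono_mod (n : ℕ) : mono e vac (n % 64) = mono e vac n := by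
  refine monomial_congr fun a _ => ?_
  rw [bits, bits, show 64 = 2 ^ 6 from rfl, Nat.testBit_mod_two_pow]
  simp [digit_lt]

theorem eval_cons (c : ℤ × ℕ) (v : Vec) :
    eval e vac (c :: v) = (c.1 : ℂ) • mono e vac c.2 + eval e vac v := by
  simp [eval]

theorem eval_append (v w : Vec) : eval e vac (v ++ w) = eval e vac v + eval e vac w := by
  simp [eval]

theorem eval_eq_sum (v : Vec) :
    eval e vac v = ∑ n ∈ Finset.range 64, (coeff v n : ℂ) • mono e vac n := by
  induction v with
  | nil => simp [eval, coeff]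
  | cons c v ih =>
    have h1 : ∀ n, coeff (c :: v) n = (if c.2 % 64 = n then c.1 else 0) + coeff v n := by
      intro n
      simp [coeff]
    simp only [h1, Int.cast_add, add_smul, Finset.sum_add_distrib]
    have h2 : ∑ n ∈ Finset.range 64, ((if c.2 % 64 = n then c.1 else 0 : ℤ) : ℂ) • mono e vac n =
        (c.1 : ℂ) • mono e vac c.2 := by
      rw [Finset.sum_eq_single (c.2 % 64), if_pos rfl, mono_mod]
      · intro n _ hn
        rw [if_neg hn.symm, Int.cast_zero, zero_smul]
      · intro hn
        exact absurd (Finset.mem_range.2 (Nat.mod_lt _ (by norm_num))) hn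
    rw [eval_cons, ih, h2]

theorem Equiv.eval_eq {v w : Vec} (h : Equiv v w) : eval e vac v = eval e vac w := by
  rw [eval_eq_sum, eval_eq_sum]
  refine Finset.sum_congr rfl fun n hn => ?_
  rw [h n (List.mem_range.2 (Finset.mem_range.1 hn))]

theorem eval_scale (c : ℤ) (v : Vec) : eval e vac (scale c v) = (c : ℂ) • eval e vac v := by
  induction v with
  | nil => simp [scale, eval]
  | cons d v ih =>
    have : scale c (d :: v) = (c * d.1, d.2) :: scale c v := rfl
    rw [this, eval_cons, eval_cons, ih, smul_add, smul_smul, Int.cast_mul]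

theorem eval_create (h : IsFock e i vac S) (a : Mode) (v : Vec) :
    eval e vac (create a v) = e a (eval e vac v) := by
  induction v with
  | nil => simp [create, eval]
  | cons c v ih =>
    have : create a (c :: v) = (if bits c.2 a then [] else
      [(moveSign (bits c.2) a modes * c.1, toggle c.2 a)]) ++ create a v := rfl
    rw [this, eval_append, eval_cons, ih, map_add, map_smul, h.e_mono]
    congr 1
    split_ifs
    · simp [eval]
    · simp [eval, smul_smul, mul_comm]

theorem eval_annihilate (h : IsFock e i vac S) (a : Mode) (v : Vec) :
    eval e vac (annihilate a v) = i a (eval e vac v) := by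
  induction v with
  | nil => simp [annihilate, eval]
  | cons c v ih =>
    have : annihilate a (c :: v) = (if bits c.2 a then
      [(moveSign (bits c.2) a modes * c.1, toggle c.2 a)] else []) ++ annihilate a v := rfl
    rw [this, eval_append, eval_cons, ih, map_add, map_smul, h.i_mono]
    congr 1
    split_ifs
    · simp [eval, smul_smul, mul_comm]
    · simp [eval]

theorem eval_act (h : IsFock e i vac S) (T : Cubic) (v : Vec) :
    eval e vac (T.act v) = T.op e i (eval e vac v) := by
  induction T with
  | nil => simp [Cubic.act, Cubic.op, eval]
  | cons c T ih =>
    have h1 : Cubic.act (c :: T) v = scale c.1 (create c.2.1 (create c.2.2.1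
      (annihilate c.2.2.2 v))) ++ Cubic.act T v := rfl
    rw [h1, eval_append, eval_scale, eval_create h, eval_create h, eval_annihilate h, ih]
    simp [Cubic.op]

theorem eval_mem (h : IsFock e i vac S) {v : Vec} {x : ℤ × ℤ} (hv : ∀ c ∈ v, bideg c.2 = x) :
    eval e vac v ∈ S x.1 x.2 := by
  induction v with
  | nil => exact zero_mem _
  | cons c v ih =>
    rw [eval_cons]
    refine add_mem (Submodule.smul_mem _ _ ?_) (ih fun d hd => hv d (by simp [hd]))
    rw [← hv c (by simp)]
    exact h.mono_mem _

end Vec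

/-! ### Bases that consist of squares and zigzags -/

/-- `K` is isomorphic to a family of subspaces of `V`, with differentials that are the restrictions
of `D1` and `D2`. -/
structure IsRealization (K : Bigraded) (S : ℤ → ℤ → Submodule ℂ V) (D1 D2 : V →ₗ[ℂ] V)
    (j : ∀ p q, K.X p q →ₗ[ℂ] V) : Prop where
  injective : ∀ p q, Function.Injective (j p q)
  range_eq : ∀ p q, LinearMap.range (j p q) = S p q
  d1 : ∀ p q x, j (p + 1) q (K.d1 p q x) = D1 (j p q x)
  d2 : ∀ p q x, j p (q + 1) (K.d2 p q x) = D2 (j p q x)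

/-- A family of vectors in `V`, indexed by the vertices of the shapes in `L`, defines a map of the
direct sum of the `C(S)` to `V`. -/
def sumMap (L : List (Finset (ℤ × ℤ))) (g : Fin L.length → ℤ × ℤ → V) (p q : ℤ) :
    (DirectSum (Fin L.length) fun k => comp (L.get k) p q) →ₗ[ℂ] V :=
  DirectSum.toModule ℂ (Fin L.length) V fun k =>
    LinearMap.toSpanSingleton ℂ V (g k (p, q)) ∘ₗ (comp (L.get k) p q).subtype

theorem sumMap_of (L : List (Finset (ℤ × ℤ))) (g : Fin L.length → ℤ × ℤ → V) (p q : ℤ)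
    (k : Fin L.length) (x : comp (L.get k) p q) :
    sumMap L g p q (DirectSum.lof ℂ (Fin L.length) (fun k => comp (L.get k) p q) k x) =
      x.1 • g k (p, q) := by
  rw [sumMap, DirectSum.toModule_lof]
  simp

theorem sumMap_eq_sum (L : List (Finset (ℤ × ℤ))) (g : Fin L.length → ℤ × ℤ → V) (p q : ℤ)
    (y : DirectSum (Fin L.length) fun k => comp (L.get k) p q) :
    sumMap L g p q y = ∑ k, (y k).1 • g k (p, q) := by
  conv_lhs => rw [← DirectSum.sum_univ_of y, map_sum]
  exact Finset.sum_congr rfl fun k _ => sumMap_of L g p q k _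

theorem sumMap_d1 (L : List (Finset (ℤ × ℤ))) (g : Fin L.length → ℤ × ℤ → V) (D1 : V →ₗ[ℂ] V)
    (h : ∀ k, ∀ x ∈ L.get k, D1 (g k x) =
      if (x.1 + 1, x.2) ∈ L.get k then ((-1 : ℂ) ^ x.2) • g k (x.1 + 1, x.2) else 0)
    (p q : ℤ) (y : DirectSum (Fin L.length) fun k => comp (L.get k) p q) :
    sumMap L g (p + 1) q ((Bigraded.sum fun k : Fin L.length => C (L.get k)).d1 p q y) =
      D1 (sumMap L g p q y) := by
  let z : DirectSum (Fin L.length) fun k => comp (L.get k) (p + 1) q :=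
    (Bigraded.sum fun k : Fin L.length => C (L.get k)).d1 p q y
  have h0 : ∀ k, (z k).1 = if (p + 1, q) ∈ L.get k then (-1) ^ q * (y k).1 else 0 :=
    fun k => rfl
  change sumMap L g (p + 1) q z = _
  rw [sumMap_eq_sum, sumMap_eq_sum, map_sum]
  refine Finset.sum_congr rfl fun k _ => ?_
  rw [h0, map_smul]
  by_cases hx : (p, q) ∈ L.get k
  · rw [h k _ hx]
    split_ifs
    · rw [smul_smul, mul_comm]
    · simp
  · simp [(y k).2 hx]

theorem sumMap_d2 (L : List (Finset (ℤ × ℤ))) (g : Fin L.length → ℤ × ℤ → V) (D2 : V →ₗ[ℂ] V)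
    (h : ∀ k, ∀ x ∈ L.get k, D2 (g k x) =
      if (x.1, x.2 + 1) ∈ L.get k then g k (x.1, x.2 + 1) else 0)
    (p q : ℤ) (y : DirectSum (Fin L.length) fun k => comp (L.get k) p q) :
    sumMap L g p (q + 1) ((Bigraded.sum fun k : Fin L.length => C (L.get k)).d2 p q y) =
      D2 (sumMap L g p q y) := by
  let z : DirectSum (Fin L.length) fun k => comp (L.get k) p (q + 1) :=
    (Bigraded.sum fun k : Fin L.length => C (L.get k)).d2 p q y
  have h0 : ∀ k, (z k).1 = if (p, q + 1) ∈ L.get k then (y k).1 else 0 := fun k => rfl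
  change sumMap L g p (q + 1) z = _
  rw [sumMap_eq_sum, sumMap_eq_sum, map_sum]
  refine Finset.sum_congr rfl fun k _ => ?_
  rw [h0, map_smul]
  by_cases hx : (p, q) ∈ L.get k
  · rw [h k _ hx]
    split_ifs <;> simp
  · simp [(y k).2 hx]

theorem sumMap_injective (L : List (Finset (ℤ × ℤ))) (g : Fin L.length → ℤ × ℤ → V)
    (h : LinearIndependent ℂ fun v : (k : Fin L.length) × {x // x ∈ L.get k} => g v.1 v.2.1)
    (p q : ℤ) : Function.Injective (sumMap L g p q) := by
  rw [← LinearMap.ker_eq_bot, LinearMap.ker_eq_bot']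
  intro y hy
  -- A relation in one bidegree is extended by zero to the generators in all other bidegrees, so
  -- that the global linear independence applies.
  let c : (k : Fin L.length) × {x // x ∈ L.get k} → ℂ := fun v =>
    if v.2.1 = (p, q) then (y v.1).1 else 0
  have h3 : ∑ v, c v • g v.1 v.2.1 = 0 := by
    rw [Fintype.sum_sigma, ← hy, sumMap_eq_sum]
    refine Finset.sum_congr rfl fun k _ => ?_
    by_cases hk : (p, q) ∈ L.get k
    · rw [Finset.sum_eq_single ⟨(p, q), hk⟩]
      · simp [c]
      · intro x _ hx
        have : x.1 ≠ (p, q) := fun h => hx (Subtype.ext h)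
        simp [c, this]
      · simp
    · rw [(y k).2 hk, zero_smul]
      refine Finset.sum_eq_zero fun x _ => ?_
      have : x.1 ≠ (p, q) := fun h => hk (h ▸ x.2)
      simp [c, this]
  have h4 := Fintype.linearIndependent_iff.1 h c h3
  refine DFinsupp.ext fun k => Subtype.ext ?_
  by_cases hk : (p, q) ∈ L.get k
  · have := h4 ⟨k, (p, q), hk⟩
    simpa [c] using this
  · exact (y k).2 hk

/-- Both complexes embed into `V` with the same image in each bidegree and with differentials
induced by `D1` and `D2`. The isomorphism is `j` followed by the inverse of `sumMap`. -/
theorem IsRealization.isomorphic_sum {K : Bigraded} {S : ℤ → ℤ → Submodule ℂ V}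
    {D1 D2 : V →ₗ[ℂ] V} {j : ∀ p q, K.X p q →ₗ[ℂ] V} (hK : IsRealization K S D1 D2 j)
    (L : List (Finset (ℤ × ℤ))) (g : Fin L.length → ℤ × ℤ → V)
    (h1 : ∀ k, ∀ x ∈ L.get k, D1 (g k x) =
      if (x.1 + 1, x.2) ∈ L.get k then ((-1 : ℂ) ^ x.2) • g k (x.1 + 1, x.2) else 0)
    (h2 : ∀ k, ∀ x ∈ L.get k, D2 (g k x) =
      if (x.1, x.2 + 1) ∈ L.get k then g k (x.1, x.2 + 1) else 0)
    (hi : LinearIndependent ℂ fun v : (k : Fin L.length) × {x // x ∈ L.get k} => g v.1 v.2.1)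
    (hr : ∀ p q, LinearMap.range (sumMap L g p q) = S p q) :
    K.Isomorphic (Bigraded.sum fun k : Fin L.length => C (L.get k)) := by
  let e : ∀ p q, K.X p q ≃ₗ[ℂ] (Bigraded.sum fun k : Fin L.length => C (L.get k)).X p q :=
    fun p q => (LinearEquiv.ofInjective (j p q) (hK.injective p q)).trans
      ((LinearEquiv.ofEq _ _ ((hK.range_eq p q).trans (hr p q).symm)).trans
        (LinearEquiv.ofInjective (sumMap L g p q) (sumMap_injective L g hi p q)).symm)
  have he : ∀ p q x, sumMap L g p q (e p q x) = j p q x := by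
    intro p q x
    have := LinearEquiv.apply_symm_apply
      (LinearEquiv.ofInjective (sumMap L g p q) (sumMap_injective L g hi p q))
      (LinearEquiv.ofEq _ _ ((hK.range_eq p q).trans (hr p q).symm)
        (LinearEquiv.ofInjective (j p q) (hK.injective p q) x))
    exact congrArg Subtype.val this
  refine ⟨e, fun p q x => ⟨?_, ?_⟩⟩
  · apply sumMap_injective L g hi
    exact ((he _ _ _).trans (hK.d1 p q x)).trans (((sumMap_d1 L g D1 h1 p q _).trans
      (congrArg D1 (he p q x))).symm)
  · apply sumMap_injective L g hi
    exact ((he _ _ _).trans (hK.d2 p q x)).trans (((sumMap_d2 L g D2 h2 p q _).trans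
      (congrArg D2 (he p q x))).symm)

end

/-! ### Certificates for decompositions -/

/-- The generator in bidegree `x` of the summand number `k`. -/
def generator (G : List (List ((ℤ × ℤ) × Vec))) (k : ℕ) (x : ℤ × ℤ) : Vec :=
  ((G.getD k []).lookup x).getD []

/-- The sign `(-1) ^ q`. -/
def sign (q : ℤ) : ℤ := if q % 2 = 0 then 1 else -1

theorem cast_sign (q : ℤ) : ((sign q : ℤ) : ℂ) = (-1) ^ q := by
  rw [sign]
  split_ifs with h
  · simp [(Int.even_iff.2 h).neg_one_zpow]
  · simp [(Int.odd_iff.2 (by omega : q % 2 = 1)).neg_one_zpow]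

/-- The lists `G` of generators form a basis of monomial combinations that identifies the double
complex with differentials `T1` and `T2` with the direct sum of the `C(S)`, `S ∈ L`. The lists `H`
express the monomials by the generators. -/
def IsDecomposition (T1 T2 : Cubic) (L : List (Finset (ℤ × ℤ)))
    (G : List (List ((ℤ × ℤ) × Vec))) (H : List (List (ℤ × ℕ))) : Prop :=
  (∀ k : Fin L.length, ∀ x ∈ L.get k,
    (∀ c ∈ generator G k x, bideg c.2 = x) ∧
    Vec.Equiv (T1.act (generator G k x)) (if (x.1 + 1, x.2) ∈ L.get k then
      Vec.scale (sign x.2) (generator G k (x.1 + 1, x.2)) else []) ∧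
    Vec.Equiv (T2.act (generator G k x)) (if (x.1, x.2 + 1) ∈ L.get k then
      generator G k (x.1, x.2 + 1) else [])) ∧
  (∀ n : Fin 64, (∀ c ∈ H.getD n [], bideg n ∈ L.getD c.2 ∅) ∧
    Vec.Equiv [(1, n)]
      ((H.getD n []).flatMap fun c => Vec.scale c.1 (generator G c.2 (bideg n)))) ∧
  (L.map Finset.card).sum = 64

instance (T1 T2 : Cubic) (L : List (Finset (ℤ × ℤ))) (G : List (List ((ℤ × ℤ) × Vec)))
    (H : List (List (ℤ × ℕ))) : Decidable (IsDecomposition T1 T2 L G H) :=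
  inferInstanceAs (Decidable (_ ∧ _ ∧ _))

section

variable {V : Type*} [AddCommGroup V] [Module ℂ V] {e i : Mode → V →ₗ[ℂ] V} {vac : V}
  {S : ℤ → ℤ → Submodule ℂ V} {K : Bigraded} {j : ∀ p q, K.X p q →ₗ[ℂ] V}

/-- The finite certificate is transported along `Vec.eval` to an arbitrary Fock space. `G` supplies
the vectors and the shape of the differentials, while `H` shows that the generators span. -/
theorem IsDecomposition.isomorphic {T1 T2 : Cubic} {L : List (Finset (ℤ × ℤ))}
    {G : List (List ((ℤ × ℤ) × Vec))} {H : List (List (ℤ × ℕ))}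
    (hD : IsDecomposition T1 T2 L G H) (hF : IsFock e i vac S)
    (hK : IsRealization K S (T1.op e i) (T2.op e i) j) :
    K.Isomorphic (Bigraded.sum fun k : Fin L.length => C (L.get k)) := by
  obtain ⟨h1, h2, h3⟩ := hD
  let g : Fin L.length → ℤ × ℤ → V := fun k x => Vec.eval e vac (generator G k x)
  have hm : ∀ n : Fin 64, ∃ c : List (ℤ × ℕ), (∀ d ∈ c, bideg n ∈ L.getD d.2 ∅) ∧
      mono e vac n = Vec.eval e vac
        (c.flatMap fun d => Vec.scale d.1 (generator G d.2 (bideg n))) := by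
    intro n
    refine ⟨_, (h2 n).1, ?_⟩
    rw [← (h2 n).2.eval_eq]
    simp [Vec.eval]
  have hmem : ∀ (W : Submodule ℂ V) (n : Fin 64),
      (∀ k : Fin L.length, bideg n ∈ L.get k → g k (bideg n) ∈ W) → mono e vac n ∈ W := by
    intro W n hW
    obtain ⟨c, hc, hn⟩ := hm n
    rw [hn]
    clear hn
    induction c with
    | nil => exact zero_mem _
    | cons d c ih =>
      rw [List.flatMap_cons, Vec.eval_append, Vec.eval_scale]
      refine add_mem (Submodule.smul_mem _ _ ?_) (ih fun d hd => hc d (by simp [hd]))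
      have hd := hc d (by simp)
      have hl : d.2 < L.length := by
        by_contra hl
        rw [List.getD_eq_default _ _ (not_lt.1 hl)] at hd
        simp at hd
      rw [List.getD_eq_getElem _ _ hl] at hd
      exact hW ⟨d.2, hl⟩ hd
  refine hK.isomorphic_sum L g (fun k x hx => ?_) (fun k x hx => ?_) ?_ fun p q => le_antisymm ?_ ?_
  · rw [← Vec.eval_act hF, (h1 k x hx).2.1.eval_eq]
    split_ifs
    · rw [Vec.eval_scale, cast_sign]
    · rfl
  · rw [← Vec.eval_act hF, (h1 k x hx).2.2.eval_eq]
    split_ifs <;> rfl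
  -- The shapes have 64 vertices in total, and the generators span the 64 independent monomials. A
  -- spanning family of this size is independent.
  · rw [linearIndependent_iff_card_le_finrank_span]
    have hc : Fintype.card ((k : Fin L.length) × {x // x ∈ L.get k}) = 64 := by
      rw [Fintype.card_sigma, ← h3, ← List.sum_ofFn]
      congr 1
      refine List.ext_getElem (by simp) fun n _ _ => ?_
      simp
    have h4 := finrank_span_eq_card hF.linearIndependent
    rw [Fintype.card_fin] at h4
    rw [hc, ← h4]
    have := FiniteDimensional.span_of_finite ℂ (Set.finite_range
      fun v : (k : Fin L.length) × {x // x ∈ L.get k} => g v.1 v.2.1)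
    refine Submodule.finrank_mono (Submodule.span_le.2 ?_)
    rintro _ ⟨n, rfl⟩
    exact hmem _ n fun k hk => Submodule.subset_span ⟨⟨k, bideg n, hk⟩, rfl⟩
  · rintro _ ⟨y, rfl⟩
    rw [sumMap_eq_sum]
    refine sum_mem fun k _ => ?_
    by_cases hk : (p, q) ∈ L.get k
    · exact Submodule.smul_mem _ _ (Vec.eval_mem (x := (p, q)) hF (h1 k _ hk).1)
    · rw [(y k).2 hk, zero_smul]
      exact zero_mem _
  · refine (hF.le_monoSpan p q).trans (Submodule.span_le.2 ?_)
    rintro _ ⟨n, hn, rfl⟩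
    refine hmem _ n fun k hk => ?_
    rw [hn] at hk ⊢
    refine ⟨DirectSum.lof ℂ _ _ k ⟨1, fun h => absurd hk h⟩, ?_⟩
    rw [sumMap_of, one_smul]

/-- Two combinations of operators that agree on monomials agree on all of `S p q`. -/
theorem IsFock.induction (hF : IsFock e i vac S) {p q : ℤ} (A : V →ₗ[ℂ] V) (W : Submodule ℂ V)
    (h : ∀ n : Fin 64, bideg n = (p, q) → A (mono e vac n) ∈ W) {x : V} (hx : x ∈ S p q) :
    A x ∈ W := by
  have h1 : monoSpan e vac (p, q) ≤ W.comap A := by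
    refine Submodule.span_le.2 ?_
    rintro _ ⟨n, hn, rfl⟩
    exact h n hn
  exact h1 (hF.le_monoSpan p q hx)

theorem Vec.eval_single (n : ℕ) : Vec.eval e vac [(1, n)] = mono e vac n := by
  simp [Vec.eval]

theorem IsRealization.isDoubleComplex {T1 T2 : Cubic} (hF : IsFock e i vac S)
    (hK : IsRealization K S (T1.op e i) (T2.op e i) j)
    (h : ∀ n : Fin 64, Vec.Equiv (T1.act (T1.act [(1, n)])) [] ∧
      Vec.Equiv (T2.act (T2.act [(1, n)])) [] ∧
      Vec.Equiv (T1.act (T2.act [(1, n)]) ++ T2.act (T1.act [(1, n)])) []) :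
    K.IsDoubleComplex := by
  intro p q x
  have hx : j p q x ∈ S p q := by
    rw [← hK.range_eq]
    exact ⟨x, rfl⟩
  refine ⟨hK.injective _ _ ?_, hK.injective _ _ ?_, hK.injective _ _ ?_⟩
  · rw [hK.d1, hK.d1, map_zero]
    refine (Submodule.mem_bot ℂ).1 (hF.induction (T1.op e i ∘ₗ T1.op e i) ⊥ (fun n _ => ?_) hx)
    have := (h n).1.eval_eq (e := e) (vac := vac)
    rw [Vec.eval_act hF, Vec.eval_act hF, Vec.eval_single] at this
    exact this
  · rw [hK.d2, hK.d2, map_zero]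
    refine (Submodule.mem_bot ℂ).1 (hF.induction (T2.op e i ∘ₗ T2.op e i) ⊥ (fun n _ => ?_) hx)
    have := (h n).2.1.eval_eq (e := e) (vac := vac)
    rw [Vec.eval_act hF, Vec.eval_act hF, Vec.eval_single] at this
    exact this
  · rw [map_add, hK.d1, hK.d2, hK.d2, hK.d1, map_zero]
    refine (Submodule.mem_bot ℂ).1 (hF.induction
      (T1.op e i ∘ₗ T2.op e i + T2.op e i ∘ₗ T1.op e i) ⊥ (fun n _ => ?_) hx)
    have := (h n).2.2.eval_eq (e := e) (vac := vac)
    rw [Vec.eval_append, Vec.eval_act hF, Vec.eval_act hF, Vec.eval_act hF, Vec.eval_act hF,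
      Vec.eval_single] at this
    exact this

end

/-! ### Two invariants of double complexes -/

/-- The second differential vanishes in bidegree `(2, 0)`. -/
def Bigraded.RankZero (K : Bigraded) : Prop := ∀ x, K.d2 2 0 x = 0

/-- The image of the second differential in bidegree `(2, 0)` is contained in a line. -/
def Bigraded.RankLeOne (K : Bigraded) : Prop := ∃ w, ∀ x, ∃ c : ℂ, K.d2 2 0 x = c • w

theorem Bigraded.Isomorphic.symm {K L : Bigraded} (h : K.Isomorphic L) : L.Isomorphic K := by
  obtain ⟨e, he⟩ := h
  refine ⟨fun p q => (e p q).symm, fun p q x => ⟨?_, ?_⟩⟩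
  · rw [LinearEquiv.symm_apply_eq, (he _ _ _).1, LinearEquiv.apply_symm_apply]
  · rw [LinearEquiv.symm_apply_eq, (he _ _ _).2, LinearEquiv.apply_symm_apply]

theorem Bigraded.Isomorphic.trans {K L M : Bigraded} (h : K.Isomorphic L) (h' : L.Isomorphic M) :
    K.Isomorphic M := by
  obtain ⟨e, he⟩ := h
  obtain ⟨f, hf⟩ := h'
  refine ⟨fun p q => (e p q).trans (f p q), fun p q x => ⟨?_, ?_⟩⟩
  · simp only [LinearEquiv.trans_apply, (he _ _ _).1, (hf _ _ _).1]
  · simp only [LinearEquiv.trans_apply, (he _ _ _).2, (hf _ _ _).2]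

theorem Bigraded.Isomorphic.rankZero {K L : Bigraded} (h : K.Isomorphic L) (hK : K.RankZero) :
    L.RankZero := by
  obtain ⟨e, he⟩ := h.symm
  intro x
  apply (e 2 (0 + 1)).injective
  rw [(he _ _ _).2, hK, map_zero]

theorem Bigraded.Isomorphic.rankLeOne {K L : Bigraded} (h : K.Isomorphic L) (hK : K.RankLeOne) :
    L.RankLeOne := by
  obtain ⟨e, he⟩ := h.symm
  obtain ⟨w, hw⟩ := hK
  refine ⟨(e 2 (0 + 1)).symm w, fun x => ?_⟩
  obtain ⟨c, hc⟩ := hw (e 2 0 x)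
  refine ⟨c, (e 2 (0 + 1)).injective ?_⟩
  rw [(he _ _ _).2, hc, map_smul, LinearEquiv.apply_symm_apply]

section

variable {V : Type*} [AddCommGroup V] [Module ℂ V] {e i : Mode → V →ₗ[ℂ] V} {vac : V}
  {S : ℤ → ℤ → Submodule ℂ V} {K : Bigraded} {j : ∀ p q, K.X p q →ₗ[ℂ] V} {T1 T2 : Cubic}

theorem IsRealization.rankZero (hF : IsFock e i vac S)
    (hK : IsRealization K S (T1.op e i) (T2.op e i) j)
    (h : ∀ n : Fin 64, bideg n = (2, 0) → Vec.Equiv (T2.act [(1, n)]) []) : K.RankZero := by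
  intro x
  apply hK.injective
  rw [hK.d2, map_zero]
  refine (Submodule.mem_bot ℂ).1 (hF.induction (p := 2) (q := 0) (T2.op e i) ⊥ (fun n hn => ?_) ?_)
  · have := (h n hn).eval_eq (e := e) (vac := vac)
    rw [Vec.eval_act hF, Vec.eval_single] at this
    exact this
  · rw [← hK.range_eq]
    exact ⟨x, rfl⟩

/-- Restricting the coefficient to `-1, 0, 1` makes the hypothesis a finite check. -/
theorem IsRealization.rankLeOne (hF : IsFock e i vac S)
    (hK : IsRealization K S (T1.op e i) (T2.op e i) j) (m : Fin 64) (hm : bideg m = (2, 1))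
    (h : ∀ n : Fin 64, bideg n = (2, 0) → ∃ c ∈ [-1, 0, 1],
      Vec.Equiv (T2.act [(1, n)]) [(c, m)]) : K.RankLeOne := by
  have h1 := hF.mono_mem m
  rw [hm, ← hK.range_eq] at h1
  obtain ⟨w, hw⟩ := h1
  refine ⟨w, fun x => ?_⟩
  have h2 : T2.op e i (j 2 0 x) ∈ Submodule.span ℂ {mono e vac m} := by
    refine hF.induction (p := 2) (q := 0) _ _ (fun n hn => ?_) ?_
    · obtain ⟨c, _, hc⟩ := h n hn
      have := hc.eval_eq (e := e) (vac := vac)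
      rw [Vec.eval_act hF, Vec.eval_single] at this
      rw [this]
      refine Submodule.mem_span_singleton.2 ⟨(c : ℂ), ?_⟩
      simp [Vec.eval]
    · rw [← hK.range_eq]
      exact ⟨x, rfl⟩
  obtain ⟨c, hc⟩ := Submodule.mem_span_singleton.1 h2
  refine ⟨c, hK.injective _ _ ?_⟩
  rw [hK.d2, ← hc, map_smul]
  exact congrArg (c • ·) hw.symm

theorem IsRealization.exists_d2 (hF : IsFock e i vac S)
    (hK : IsRealization K S (T1.op e i) (T2.op e i) j) (n m : Fin 64) (hn : bideg n = (2, 0))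
    (c : ℤ) (h : Vec.Equiv (T2.act [(1, n)]) [(c, m)]) :
    ∃ x, j 2 (0 + 1) (K.d2 2 0 x) = (c : ℂ) • mono e vac m := by
  have h1 := hF.mono_mem n
  rw [hn, ← hK.range_eq] at h1
  obtain ⟨x, hx⟩ := h1
  refine ⟨x, ?_⟩
  have := h.eval_eq (e := e) (vac := vac)
  rw [Vec.eval_act hF, Vec.eval_single] at this
  rw [hK.d2]
  refine (congrArg _ hx).trans (this.trans ?_)
  simp [Vec.eval]

theorem IsRealization.not_rankZero (hF : IsFock e i vac S)
    (hK : IsRealization K S (T1.op e i) (T2.op e i) j) (n m : Fin 64) (hn : bideg n = (2, 0))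
    (c : ℤ) (hc : c ≠ 0) (h : Vec.Equiv (T2.act [(1, n)]) [(c, m)]) : ¬K.RankZero := by
  intro h0
  obtain ⟨x, hx⟩ := hK.exists_d2 hF n m hn c h
  rw [h0, map_zero, eq_comm, smul_eq_zero] at hx
  exact hx.elim (by exact_mod_cast hc) (hF.linearIndependent.ne_zero m)

/-- Two images that are nonzero multiples of different monomials cannot lie on one line: eliminating
the spanning vector would give a linear relation between the monomials. -/
theorem IsRealization.not_rankLeOne (hF : IsFock e i vac S)
    (hK : IsRealization K S (T1.op e i) (T2.op e i) j) (n m n' m' : Fin 64)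
    (hn : bideg n = (2, 0)) (hn' : bideg n' = (2, 0)) (hm : m ≠ m') (c c' : ℤ) (hc : c ≠ 0)
    (hc' : c' ≠ 0) (h : Vec.Equiv (T2.act [(1, n)]) [(c, m)])
    (h' : Vec.Equiv (T2.act [(1, n')]) [(c', m')]) : ¬K.RankLeOne := by
  rintro ⟨w, hw⟩
  obtain ⟨x, hx⟩ := hK.exists_d2 hF n m hn c h
  obtain ⟨x', hx'⟩ := hK.exists_d2 hF n' m' hn' c' h'
  obtain ⟨a, ha⟩ := hw x
  obtain ⟨a', ha'⟩ := hw x'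
  rw [ha, map_smul] at hx
  rw [ha', map_smul] at hx'
  have h1 : (a' * c) • mono e vac m + (-(a * c')) • mono e vac m' = 0 := by
    rw [mul_smul, ← hx, neg_smul, mul_smul, ← hx', smul_comm, add_neg_cancel]
  have h2 : LinearIndependent ℂ ![mono e vac m, mono e vac m'] := by
    have h3 : Function.Injective ![m, m'] := by
      intro a b
      fin_cases a <;> fin_cases b <;> simp [hm, hm.symm]
    have h6 : (fun n : Fin 64 => mono e vac n) ∘ ![m, m'] = ![mono e vac m, mono e vac m'] := by
      funext a
      fin_cases a <;> rfl
    rw [← h6]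
    exact hF.linearIndependent.comp _ h3
  have h4 : a * c' = 0 := neg_eq_zero.1 (LinearIndependent.pair_iff.1 h2 _ _ h1).2
  have h5 : a = 0 := (mul_eq_zero.1 h4).resolve_right (by exact_mod_cast hc')
  rw [h5, zero_smul, eq_comm, smul_eq_zero] at hx
  exact hx.elim (by exact_mod_cast hc) (hF.linearIndependent.ne_zero m)

end

/-! ### Left invariant forms as a Fock space -/

/-- In total degree 0 a form is a function and is unaffected by scaling the empty list of arguments,
so type `(p, -p)` with `p ≠ 0` forces it to vanish. In negative total degree there are no forms. -/
theorem invForms_eq_zero {p q : ℤ} (h : p + q ≤ 0) (h0 : ¬(p = 0 ∧ q = 0)) {α : Forms}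
    (hα : α ∈ invForms p q) : α = 0 := by
  obtain ⟨hk, ht⟩ := (mem_invForms.1 hα).2.1
  funext k
  by_cases hkp : (k : ℤ) = p + q
  · obtain rfl : k = 0 := by omega
    have hp : p ≠ 0 := by omega
    obtain rfl : q = -p := by push_cast at hkp; omega
    funext z
    ext v
    -- Choose the scalar `c` with `c ^ p = i`. Then `c ^ p * conj c ^ (-p) = -1`, so the function
    -- equals its negative.
    have h1 : Complex.exp (Real.pi / (2 * p) * Complex.I) ^ p = Complex.I := by
      have hp' : (p : ℂ) ≠ 0 := by exact_mod_cast hp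
      rw [← Complex.exp_int_mul, show (p : ℂ) * (Real.pi / (2 * p) * Complex.I) =
        Real.pi / 2 * Complex.I by field_simp, Complex.exp_pi_div_two_mul_I]
    have h2 := ht 0 z _ (Complex.exp_ne_zero (Real.pi / (2 * p) * Complex.I)) v
    rw [zpow_neg, ← map_zpow₀, h1, Subsingleton.elim (fun j => _) v] at h2
    have h3 : Complex.I * (conj Complex.I)⁻¹ = -1 := by
      rw [Complex.conj_I, inv_neg, Complex.inv_I, neg_neg, Complex.I_mul_I]
    rw [h3] at h2
    change α 0 z v = 0
    linear_combination (1 / 2 : ℂ) * h2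
  · exact hk k hkp

theorem invForms_isFock : IsFock stdE stdI vac invForms where
  car := stdE_isCAR
  e_inl j _ _ _ hx := wedge_coframe_mem j hx
  e_inr j _ _ _ hx := wedge_coframeBar_mem j hx
  i_inl j _ _ _ hx := insertFrame_mem j hx
  i_inr j _ _ _ hx := insertFrameBar_mem j hx
  number _ _ _ hx := sum_stdE_stdI hx
  vac_mem := vac_mem
  le_span α hα := by
    -- A left invariant function is constant, so it is its value at the origin times the function
    -- `1`.
    refine Submodule.mem_span_singleton.2 ⟨α 0 0 ![], ?_⟩
    obtain ⟨_, ⟨hk, _⟩, hg⟩ := mem_invForms.1 hα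
    funext k z
    ext v
    cases k with
    | zero =>
      exact (mul_one _).trans ((congrArg (α 0 0) (Subsingleton.elim _ _)).trans
        (DFunLike.congr_fun (invariant_eq hg 0 z) v).symm)
    | succ k =>
      rw [hk (k + 1) (by push_cast; omega)]
      simp [vac]
  eq_bot _ _ h h0 := (Submodule.eq_bot_iff _).2 fun _ hα => invForms_eq_zero h h0 hα

/-! ### The Beltrami contraction as an operator, and changes of frame -/

section

variable {V : Type*} [AddCommGroup V] [Module ℂ V]

/-- The contraction with the Beltrami differential in terms of creation and annihilation
operators. -/
def contractOp (e i : Mode → V →ₗ[ℂ] V) (t : Param) : V →ₗ[ℂ] V :=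
  ∑ k : Fin 3, ∑ l : Fin 2, t k l • (e (.inr l.castSucc) ∘ₗ i (.inl k)) -
    D t • (e (.inr 2) ∘ₗ i (.inl 2))

/-- The operator `∂` in terms of creation and annihilation operators. -/
def delCubic : Cubic := [(-1, .inl 0, .inl 1, .inl 2)]

theorem delCubic_op (e i : Mode → V →ₗ[ℂ] V) (x : V) :
    delCubic.op e i x = -e (.inl 0) (e (.inl 1) (i (.inl 2) x)) := by
  simp [delCubic, Cubic.op]

/-- The operator `∂̄_{φ(t)}` in terms of creation and annihilation operators. -/
def delbarOp (e i : Mode → V →ₗ[ℂ] V) (t : Param) (x : V) : V :=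
  -e (.inr 0) (e (.inr 1) (i (.inr 2) x)) +
    (e (.inl 0) (t 1 0 • e (.inr 0) (i (.inl 2) x) + t 1 1 • e (.inr 1) (i (.inl 2) x)) -
      e (.inl 1) (t 0 0 • e (.inr 0) (i (.inl 2) x) + t 0 1 • e (.inr 1) (i (.inl 2) x)))

namespace IsCAR

variable {e i : Mode → V →ₗ[ℂ] V} {vac : V}

/-- The operators `ē m i d` and `e₀ e₁ i₂` fail to commute only through the contraction of `i d`
with `e₀` or `e₁`. For `d = 2` there is no such contraction, which is why the `θ³` components of the
Beltrami differential disappear. -/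
theorem commutator_term (h : IsCAR e i vac) (m d : Fin 3) (x : V) :
    e (.inr m) (i (.inl d) (e (.inl 0) (e (.inl 1) (i (.inl 2) x)))) -
      e (.inl 0) (e (.inl 1) (i (.inl 2) (e (.inr m) (i (.inl d) x)))) =
    e (.inr m) ((if d = 0 then e (.inl 1) (i (.inl 2) x) else 0) -
      (if d = 1 then e (.inl 0) (i (.inl 2) x) else 0)) := by
  rw [h.ie (.inl d) (.inl 0), h.ie (.inl d) (.inl 1), h.ie (.inl 2) (.inr m),
    h.ii (.inl 2) (.inl d), if_neg (by simp : ¬((.inl 2 : Mode) = .inr m)), zero_sub]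
  simp only [map_neg, map_sub, neg_neg, h.ee (.inl 1) (.inr m), h.ee (.inl 0) (.inr m),
    Sum.inl.injEq, apply_ite (e (.inl 0)), apply_ite (e (.inr m)), map_zero]
  abel

theorem commutator (h : IsCAR e i vac) (t : Param) (x : V) :
    contractOp e i t (delCubic.op e i x) - delCubic.op e i (contractOp e i t x) =
      -(delbarOp e i t x + e (.inr 0) (e (.inr 1) (i (.inr 2) x))) := by
  have h0 := fun m => h.commutator_term m 0 x
  have h1 := fun m => h.commutator_term m 1 x
  have h2 := fun m => h.commutator_term m 2 x
  simp only [if_true, sub_zero, zero_sub, map_neg, map_zero, Fin.isValue, Fin.reduceEq, if_false,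
    h.ee (.inr _) (.inl _), one_ne_zero, zero_ne_one] at h0 h1 h2
  simp only [delCubic_op, contractOp, delbarOp, Fin.sum_univ_three, Fin.sum_univ_two,
    LinearMap.sub_apply, LinearMap.add_apply, LinearMap.smul_apply, LinearMap.comp_apply, map_add,
    map_sub, map_smul, map_neg, Fin.castSucc_zero, Fin.castSucc_one]
  linear_combination (norm := module) (-t 0 0) • h0 0 - t 0 1 • h0 1 - t 1 0 • h1 0 - t 1 1 • h1 1 -
    t 2 0 • h2 0 - t 2 1 • h2 1 + D t • h2 2

/-- The product of two combinations of two anticommuting operators is their determinant times the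
product. -/
theorem pair (h : IsCAR e i vac) (a b : Mode) (p q r s : ℂ) (y : V) :
    (p • e a + q • e b) ((r • e a + s • e b) y) = (p * s - q * r) • e a (e b y) := by
  simp only [LinearMap.add_apply, LinearMap.smul_apply, map_add, map_smul, h.ee_self, h.ee b a]
  module

end IsCAR

/-- Change of frame by a unimodular transformation of `e 0, e 1` and a compatible invertible
transformation of `ē 0, ē 1, ē 2`. -/
theorem IsFock.exists_frame {e i : Mode → V →ₗ[ℂ] V} {vac : V} {S : ℤ → ℤ → Submodule ℂ V}
    (h : IsFock e i vac S) (p q r s u v w z : ℂ) (h1 : p * s - q * r = 1)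
    (h2 : u * z - v * w ≠ 0) : ∃ e' i' : Mode → V →ₗ[ℂ] V, IsFock e' i' vac S ∧
      e' (.inl 0) = p • e (.inl 0) + q • e (.inl 1) ∧
      e' (.inl 1) = r • e (.inl 0) + s • e (.inl 1) ∧
      e' (.inr 0) = u • e (.inr 0) + v • e (.inr 1) ∧
      e' (.inr 1) = w • e (.inr 0) + z • e (.inr 1) ∧ i' (.inl 2) = i (.inl 2) ∧
      (∀ x, e' (.inl 0) (e' (.inl 1) (i' (.inl 2) x)) = e (.inl 0) (e (.inl 1) (i (.inl 2) x))) ∧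
      (∀ x, e' (.inr 0) (e' (.inr 1) (i' (.inr 2) x)) =
        e (.inr 0) (e (.inr 1) (i (.inr 2) x))) := by
  set d := u * z - v * w with hd
  have hP : (!![s, -r, 0; -q, p, 0; 0, 0, 1] : Matrix (Fin 3) (Fin 3) ℂ) *
      (!![p, q, 0; r, s, 0; 0, 0, 1] : Matrix (Fin 3) (Fin 3) ℂ).transpose = 1 := by
    ext a b
    fin_cases a <;> fin_cases b <;> simp [Matrix.mul_apply, Fin.sum_univ_three] <;>
      first | linear_combination h1 | ring
  -- The third barred creation operator is scaled by `d`, hence its annihilation operator by `1 /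
  -- d`. This compensates the determinant `d` of the change of the first two, so `ē₀ ē₁ ī₂` is
  -- preserved.
  have hR : (!![z / d, -w / d, 0; -v / d, u / d, 0; 0, 0, 1 / d] : Matrix (Fin 3) (Fin 3) ℂ) *
      (!![u, v, 0; w, z, 0; 0, 0, d] : Matrix (Fin 3) (Fin 3) ℂ).transpose = 1 := by
    ext a b
    fin_cases a <;> fin_cases b <;> simp [Matrix.mul_apply, Fin.sum_univ_three] <;>
      field_simp <;> rw [hd] <;> ring
  have hF := h.change hP hR
  refine ⟨_, _, hF, ?_⟩
  have e0 : ∀ f : Mode → V →ₗ[ℂ] V, ∀ a b c a' b' c' a'' b'' c'' : ℂ,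
      ∀ j : Fin 3 → Mode, (fun k => ∑ l, (!![a, b, c; a', b', c'; a'', b'', c''] :
        Matrix (Fin 3) (Fin 3) ℂ) k l • f (j l)) = ![a • f (j 0) + b • f (j 1) + c • f (j 2),
          a' • f (j 0) + b' • f (j 1) + c' • f (j 2),
          a'' • f (j 0) + b'' • f (j 1) + c'' • f (j 2)] := by
    intro f a b c a' b' c' a'' b'' c'' j
    funext k
    fin_cases k <;> simp [Fin.sum_univ_three]
  simp only [e0, Sum.elim_inl, Sum.elim_inr, Matrix.cons_val, zero_smul, add_zero, zero_add,
    one_smul, true_and]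
  refine ⟨fun x => ?_, fun x => ?_⟩
  · rw [h.car.pair, h1, one_smul]
  · rw [h.car.pair, ← hd, LinearMap.smul_apply, map_smul, map_smul, smul_smul,
      mul_one_div_cancel h2, one_smul]

end

theorem contract_eq (t : Param) (α : Forms) :
    contract (beltrami t) α = contractOp stdE stdI t α := by
  rw [contract_beltrami]
  simp only [contractOp, LinearMap.sub_apply, LinearMap.sum_apply]
  rfl

theorem delbarPhi_invariant (t : Param) {p q : ℤ} {α : Forms} (h : α ∈ invForms p q) :
    delbarPhi t α = delbarOp stdE stdI t α := by
  have h1 : del α = delCubic.op stdE stdI α := (del_invariant h).trans (delCubic_op _ _ _).symm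
  have h2 : del (contract (beltrami t) α) = delCubic.op stdE stdI (contract (beltrami t) α) :=
    (del_invariant (contract_mem t h)).trans (delCubic_op _ _ _).symm
  rw [delbarPhi, h1, h2, contract_eq, contract_eq, stdE_isCAR.commutator, delbar_invariant h]
  abel

/-! ### Normal forms -/

/-- The operator `∂̄_{φ(t)}` in an adapted frame, without the part of `∂̄`. -/
def barCubic (T : Cubic) : Cubic := (-1, .inr 0, .inr 1, .inr 2) :: T

/-- The normal form of `t` if the matrix `(t i λ)`, `i ≤ 2`, has rank one. -/
def cubicOne : Cubic := [(1, .inl 0, .inr 0, .inl 2)]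

/-- The normal form of `t` if the matrix `(t i λ)`, `i ≤ 2`, has rank two. -/
def cubicTwo : Cubic := [(1, .inl 0, .inr 1, .inl 2), (-1, .inl 1, .inr 0, .inl 2)]

/-- The bidegree of a combination of monomials. -/
def Vec.bidegree (v : Vec) : ℤ × ℤ := bideg v.headI.2

/-- The target of the first differential, with the sign of `C(S)`. -/
def delTarget (v : Vec) : (ℤ × ℤ) × Vec :=
  (v.bidegree + (1, 0), Vec.scale (sign v.bidegree.2) (delCubic.act v))

/-- The target of the second differential. -/
def barTarget (T : Cubic) (v : Vec) : (ℤ × ℤ) × Vec := (v.bidegree + (0, 1), (barCubic T).act v)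

/-- The generator of a dot. -/
def dotGens (v : Vec) : List ((ℤ × ℤ) × Vec) := [(v.bidegree, v)]

/-- The generators of a horizontal arrow with source `v`. -/
def hArrowGens (v : Vec) : List ((ℤ × ℤ) × Vec) := [(v.bidegree, v), delTarget v]

/-- The generators of a vertical arrow with source `v`. -/
def vArrowGens (T : Cubic) (v : Vec) : List ((ℤ × ℤ) × Vec) := [(v.bidegree, v), barTarget T v]

/-- The generators of two arrows with common source `v`. -/
def forkGens (T : Cubic) (v : Vec) : List ((ℤ × ℤ) × Vec) :=
  [(v.bidegree, v), delTarget v, barTarget T v]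

/-- The generators of two arrows with a common target and sources `v` and `w`. -/
def jointGens (T : Cubic) (v w : Vec) : List ((ℤ × ℤ) × Vec) :=
  [(v.bidegree, v), (w.bidegree, w), barTarget T v]

/-- The generators of a square with lower left corner `v`. -/
def squareGens (T : Cubic) (v : Vec) : List ((ℤ × ℤ) × Vec) :=
  [(v.bidegree, v), delTarget v, barTarget T v,
    (v.bidegree + (1, 1), (barCubic T).act (delTarget v).2)]

/-- The basis in the case of rank zero. -/
def generatorsZero (T : Cubic) : List (List ((ℤ × ℤ) × Vec)) :=
    -- The lists follow the order of the shapes in the diagram. Binary digits encode monomials,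
    -- lowest first: 1, 2, 4 stand for `φ¹, φ², φ³` and 8, 16, 32 for their conjugates; thus 36 is
    -- `φ³ ∧ φ̄³`.
    [squareGens T [(1, 36)], vArrowGens T [(1, 32)], vArrowGens T [(1, 33)],
    vArrowGens T [(1, 34)], vArrowGens T [(1, 37)], vArrowGens T [(1, 38)],
    vArrowGens T [(1, 39)]] ++
    [[(1, 0)], [(1, 1)], [(1, 2)], [(1, 7)], [(1, 8)], [(1, 16)], [(1, 9)], [(1, 17)], [(1, 10)],
    [(1, 13)], [(1, 21)], [(1, 14)], [(1, 22)], [(1, 15)], [(1, 23)], [(1, 40)], [(1, 48)],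
    [(1, 41)], [(1, 49)], [(1, 42)], [(1, 50)], [(1, 45)], [(1, 53)], [(1, 46)], [(1, 47)],
    [(1, 55)], [(1, 56)], [(1, 61)], [(1, 62)], [(1, 63)]].map dotGens ++
    [hArrowGens [(1, 4)], hArrowGens [(1, 12)], hArrowGens [(1, 20)], hArrowGens [(1, 44)],
    hArrowGens [(1, 52)], hArrowGens [(1, 60)]] ++
    [[(1, 5)], [(1, 6)], [(1, 18)], [(1, 54)], [(1, 57)], [(1, 58)]].map dotGens

/-- The monomials in terms of `generatorsZero`. -/
def monomialsZero : List (List (ℤ × ℕ)) :=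
    [[(1, 7)], [(1, 8)], [(1, 9)], [(-1, 37)], [(1, 37)], [(1, 43)], [(1, 44)], [(1, 10)],
    [(1, 11)], [(1, 13)], [(1, 15)], [(1, 38)], [(1, 38)], [(1, 16)], [(1, 18)], [(1, 20)],
    [(1, 12)], [(1, 14)], [(1, 45)], [(1, 39)], [(1, 39)], [(1, 17)], [(1, 19)], [(1, 21)],
    [(-1, 1)], [(1, 2)], [(1, 3)], [(-1, 0)], [(1, 0)], [(-1, 4)], [(-1, 5)], [(1, 6)], [(1, 1)],
    [(1, 2)], [(1, 3)], [(1, 0)], [(1, 0)], [(1, 4)], [(1, 5)], [(1, 6)], [(1, 22)], [(1, 24)],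
    [(1, 26)], [(-1, 40)], [(1, 40)], [(1, 28)], [(1, 30)], [(1, 31)], [(1, 23)], [(1, 25)],
    [(1, 27)], [(-1, 41)], [(1, 41)], [(1, 29)], [(1, 46)], [(1, 32)], [(1, 33)], [(1, 47)],
    [(1, 48)], [(1, 42)], [(1, 42)], [(1, 34)], [(1, 35)], [(1, 36)]]

/-- The basis in the case of rank one. -/
def generatorsOne (T : Cubic) : List (List ((ℤ × ℤ) × Vec)) :=
    [squareGens T [(1, 36)], vArrowGens T [(1, 32)], vArrowGens T [(1, 33)],
    vArrowGens T [(1, 34)], vArrowGens T [(1, 37)], vArrowGens T [(1, 38)],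
    vArrowGens T [(1, 39)]] ++
    [[(1, 0)], [(1, 1)], [(1, 2)], [(1, 7)], [(1, 8)], [(1, 16)], [(1, 17)], [(1, 10)], [(1, 18)],
    -- Monomials such as 22 and 20 are no longer closed under the second differential. Adding a
    -- multiple of a monomial with the factor `φ̄³` but without `φ³`, here 35 and 33, cancels the
    -- new term by `∂̄` and leaves `∂` unchanged.
    [(1, 13)], [(1, 21)], [(1, 14)], [(1, 22), (1, 35)], [(1, 15)], [(1, 23)], [(1, 40)],
    [(1, 48)], [(1, 41)], [(1, 49)], [(1, 42)], [(1, 50)], [(1, 45)], [(1, 53)], [(1, 46)],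
    [(1, 47)], [(1, 55)], [(1, 56)], [(1, 61)], [(1, 62)], [(1, 63)]].map dotGens ++
    [forkGens T [(1, 4)], jointGens T [(1, 6)] [(1, 12)], hArrowGens [(1, 20), (-1, 33)],
    hArrowGens [(1, 44)], forkGens T [(1, 52)], jointGens T [(1, 54)] [(1, 60)]] ++
    [[(1, 5)], [(1, 58)]].map dotGens

/-- The monomials in terms of `generatorsOne`. -/
def monomialsOne : List (List (ℤ × ℕ)) :=
    [[(1, 7)], [(1, 8)], [(1, 9)], [(-1, 37)], [(1, 37)], [(1, 43)], [(1, 38)], [(1, 10)],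
    [(1, 11)], [(1, 37)], [(1, 14)], [(1, 38)], [(1, 38)], [(1, 16)], [(1, 18)], [(1, 20)],
    [(1, 12)], [(1, 13)], [(1, 15)], [(1, 39)], [(1, 2), (1, 39)], [(1, 17)], [(-1, 0), (1, 19)],
    [(1, 21)], [(-1, 1)], [(1, 2)], [(1, 3)], [(-1, 0)], [(1, 0), (-1, 24)], [(-1, 4)],
    [(-1, 5), (-1, 40)], [(1, 6)], [(1, 1)], [(1, 2)], [(1, 3)], [(1, 0)], [(1, 0)], [(1, 4)],
    [(1, 5)], [(1, 6)], [(1, 22)], [(1, 24)], [(1, 26)], [(-1, 40)], [(1, 40)], [(1, 28)],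
    [(1, 30)], [(1, 31)], [(1, 23)], [(1, 25)], [(1, 27)], [(-1, 41)], [(1, 41)], [(1, 29)],
    [(1, 42)], [(1, 32)], [(1, 33)], [(1, 41)], [(1, 44)], [(1, 42)], [(1, 42)], [(1, 34)],
    [(1, 35)], [(1, 36)]]

/-- The basis in the case of rank two. -/
def generatorsTwo (T : Cubic) : List (List ((ℤ × ℤ) × Vec)) :=
    [squareGens T [(1, 36)], vArrowGens T [(1, 32)], vArrowGens T [(1, 33)],
    vArrowGens T [(1, 34)], vArrowGens T [(1, 37)], vArrowGens T [(1, 38)],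
    vArrowGens T [(1, 39)]] ++
    [[(1, 0)], [(1, 1)], [(1, 2)], [(1, 7)], [(1, 8)], [(1, 16)], [(1, 9)], [(1, 17)], [(1, 18)],
    [(1, 13)], [(1, 22)], [(1, 21), (1, 35)], [(1, 14), (-1, 35)], [(1, 15)], [(1, 23)],
    [(1, 40)], [(1, 48)], [(1, 41)], [(1, 49)], [(1, 42)], [(1, 50)], [(1, 45)], [(1, 54)],
    -- The new terms of the second differential on 53 and 46 cancel each other, so their sum gives a
    -- dot, while 53 alone is a source of the last joint.
    [(1, 53), (1, 46)], [(1, 47)], [(1, 55)], [(1, 56)], [(1, 61)], [(1, 62)], [(1, 63)]].map dotGens ++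
    [forkGens T [(1, 4)], jointGens T [(1, 5)] [(1, 12), (1, 33)],
    jointGens T [(1, 6)] [(1, 20), (1, 34)], forkGens T [(1, 44)], forkGens T [(1, 52)],
    jointGens T [(1, 53)] [(1, 60)]]

/-- The monomials in terms of `generatorsTwo`. -/
def monomialsTwo : List (List (ℤ × ℕ)) :=
    [[(1, 7)], [(1, 8)], [(1, 9)], [(-1, 37)], [(1, 37)], [(1, 38)], [(1, 39)], [(1, 10)],
    [(1, 11)], [(1, 13)], [(1, 14), (-1, 37)], [(1, 38)], [(-1, 2), (1, 38)], [(1, 16)],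
    [(1, 0), (1, 19)], [(1, 20)], [(1, 12)], [(1, 14)], [(1, 15)], [(1, 39)], [(-1, 3), (1, 39)],
    [(-1, 0), (1, 18)], [(1, 17)], [(1, 21)], [(-1, 1)], [(1, 2)], [(1, 3)], [(-1, 0)],
    [(1, 0), (-1, 25), (1, 26)], [(-1, 4), (-1, 40)], [(-1, 5), (-1, 41)], [(1, 6)], [(1, 1)],
    [(1, 2)], [(1, 3)], [(1, 0)], [(1, 0)], [(1, 4)], [(1, 5)], [(1, 6)], [(1, 22)], [(1, 24)],
    [(1, 26)], [(-1, 40)], [(1, 40)], [(1, 28)], [(1, 30), (-1, 42)], [(1, 31)], [(1, 23)],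
    [(1, 25)], [(1, 27)], [(-1, 41)], [(1, 41)], [(1, 42)], [(1, 29)], [(1, 32)], [(1, 33)],
    [(-1, 40)], [(-1, 41)], [(1, 42)], [(1, 42)], [(1, 34)], [(1, 35)], [(1, 36)]]

theorem isDecomposition_zero : IsDecomposition delCubic (barCubic []) diagram1
    (generatorsZero []) monomialsZero := by
  decide +kernel

theorem isDecomposition_one : IsDecomposition delCubic (barCubic cubicOne) diagram2
    (generatorsOne cubicOne) monomialsOne := by
  decide +kernel

theorem isDecomposition_two : IsDecomposition delCubic (barCubic cubicTwo) diagram3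
    (generatorsTwo cubicTwo) monomialsTwo := by
  decide +kernel

/-! ### The three cases -/

theorem isSquare_or_isZigzag_dot (p q : ℤ) : IsSquare (dot p q) ∨ IsZigzag (dot p q) :=
  .inr ⟨p, q, 0, 0, le_rfl, by simp [dot, staircase]⟩

theorem isSquare_or_isZigzag_hArrow (p q : ℤ) : IsSquare (hArrow p q) ∨ IsZigzag (hArrow p q) :=
  .inr ⟨p, q, 0, 1, by norm_num, by
    rw [show Finset.Icc (0 : ℤ) 1 = {0, 1} from rfl]
    simp [hArrow, staircase]⟩

theorem isSquare_or_isZigzag_vArrow (p q : ℤ) : IsSquare (vArrow p q) ∨ IsZigzag (vArrow p q) :=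
  -- Integer division rounds down, so vertex number `-1` of the staircase is `(p, q + 1)`.
  .inr ⟨p, q, -1, 0, by norm_num, by
    rw [show Finset.Icc (-1 : ℤ) 0 = {0, -1} by decide]
    simp [vArrow, staircase]⟩

theorem isSquare_or_isZigzag_fork (p q : ℤ) : IsSquare (fork p q) ∨ IsZigzag (fork p q) :=
  .inr ⟨p, q, -1, 1, by norm_num, by
    rw [show Finset.Icc (-1 : ℤ) 1 = {-1, 0, 1} from rfl]
    simp [fork, staircase]⟩

theorem isSquare_or_isZigzag_joint (p q : ℤ) : IsSquare (joint p q) ∨ IsZigzag (joint p q) :=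
  .inr ⟨p - 1, q, 0, 2, by norm_num, by
    rw [show Finset.Icc (0 : ℤ) 2 = {0, 1, 2} from rfl]
    simp [joint, staircase]⟩

theorem isSquare_or_isZigzag_square (p q : ℤ) : IsSquare (square p q) ∨ IsZigzag (square p q) :=
  .inl ⟨p, q, rfl⟩

theorem isSquare_or_isZigzag_diagram0 : ∀ S ∈ diagram0, IsSquare S ∨ IsZigzag S := by
  simp only [diagram0, List.forall_mem_append, List.forall_mem_replicate, List.mem_singleton,
    forall_eq, isSquare_or_isZigzag_dot, isSquare_or_isZigzag_vArrow, isSquare_or_isZigzag_square,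
    or_true, and_true]

/-- The rank of the matrix `(t i λ)`, `i ≤ 2`. -/
def rank (t : Param) : Fin 3 :=
  open Classical in
  if (t 0 0, t 0 1, t 1 0, t 1 1) = 0 then 0 else if D t = 0 then 1 else 2

/-- The diagrams, indexed by the rank. -/
def diagram : Fin 3 → List (Finset (ℤ × ℤ)) := ![diagram1, diagram2, diagram3]

theorem isSquare_or_isZigzag_diagram (k : Fin 3) : ∀ S ∈ diagram k, IsSquare S ∨ IsZigzag S := by
  fin_cases k <;>
  · simp only [diagram, diagram1, diagram2, diagram3, Matrix.cons_val, Fin.zero_eta, Fin.mk_one,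
      Fin.reduceFinMk, Fin.isValue]
    simp only [List.forall_mem_append, List.forall_mem_replicate, isSquare_or_isZigzag_dot,
      isSquare_or_isZigzag_hArrow, isSquare_or_isZigzag_fork, isSquare_or_isZigzag_joint, or_true,
      and_true]
    exact isSquare_or_isZigzag_diagram0

/-- The normal forms of the family. -/
def normalForm : Fin 3 → Cubic := ![[], cubicOne, cubicTwo]

theorem D_eq_zero_of_eq_zero {t : Param} (h : (t 0 0, t 0 1, t 1 0, t 1 1) = 0) : D t = 0 := by
  simp only [Prod.mk_eq_zero] at h
  simp [D, h]

theorem exists_unimodular_of_ne_zero {u v : ℂ} (h : ¬(u = 0 ∧ v = 0)) :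
    ∃ w z : ℂ, u * z - v * w = 1 := by
  by_cases hu : u = 0
  · have hv : v ≠ 0 := fun hv => h ⟨hu, hv⟩
    exact ⟨-v⁻¹, 0, by simp [hv]⟩
  · exact ⟨0, u⁻¹, by simp [hu]⟩

/-- A matrix of rank one is a column times a row: `(t₂λ, -t₁λ) = (p, q) ⊗ (u, v)`, with the order
and the sign in which the entries occur in `delbarOp`. Both factors are completed to unimodular
matrices, as required by `IsFock.exists_frame`. -/
theorem exists_factorization {t : Param} (h : (t 0 0, t 0 1, t 1 0, t 1 1) ≠ 0) (hD : D t = 0) :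
    ∃ p q r s u v w z : ℂ, p * s - q * r = 1 ∧ u * z - v * w = 1 ∧
      p * u = t 1 0 ∧ p * v = t 1 1 ∧ q * u = -t 0 0 ∧ q * v = -t 0 1 := by
  by_cases h1 : t 1 0 = 0 ∧ t 1 1 = 0
  · have h2 : ¬(t 0 0 = 0 ∧ t 0 1 = 0) := by
      rintro ⟨h2, h3⟩
      exact h (by simp [h1, h2, h3])
    obtain ⟨w, z, h3⟩ := exists_unimodular_of_ne_zero h2
    exact ⟨0, -1, 1, 0, _, _, w, z, by ring, h3, by simp [h1], by simp [h1], by ring, by ring⟩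
  · obtain ⟨w, z, h3⟩ := exists_unimodular_of_ne_zero h1
    have hD' : t 0 0 * t 1 1 - t 1 0 * t 0 1 = 0 := hD
    -- The row `(u, v)` is `(t₂₁, t₂₂)`, and `-q` is the factor of proportionality of `(t₁₁, t₁₂)`
    -- to it, found by pairing with `(z, -w)`.
    refine ⟨1, -(t 0 0 * z - t 0 1 * w), 0, 1, _, _, w, z, by ring, h3, by ring, by ring, ?_, ?_⟩
    · linear_combination -t 0 0 * h3 - w * hD'
    · linear_combination -t 0 1 * h3 - z * hD'

/-- In rank one the new `e₀` and `ē₀` are the two factors of the matrix. In rank two `e₀, e₁` are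
kept and the rows of the matrix are taken as the new `ē₀, ē₁`, with determinant `D t`. -/
theorem exists_adapted_frame {V : Type*} [AddCommGroup V] [Module ℂ V] {e i : Mode → V →ₗ[ℂ] V}
    {vac : V} {S : ℤ → ℤ → Submodule ℂ V} (h : IsFock e i vac S) (t : Param) :
    ∃ e' i' : Mode → V →ₗ[ℂ] V, IsFock e' i' vac S ∧
      (∀ x, delCubic.op e' i' x = delCubic.op e i x) ∧
      (∀ x, (barCubic (normalForm (rank t))).op e' i' x = delbarOp e i t x) := by
  by_cases h0 : (t 0 0, t 0 1, t 1 0, t 1 1) = 0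
  · refine ⟨e, i, h, fun _ => rfl, fun x => ?_⟩
    have h1 := h0
    simp only [Prod.mk_eq_zero] at h1
    simp [rank, normalForm, barCubic, Cubic.op, delbarOp, h1]
  by_cases hD : D t = 0
  · obtain ⟨p, q, r, s, u, v, w, z, h1, h2, h3, h4, h5, h6⟩ := exists_factorization h0 hD
    obtain ⟨e', i', hF, he0, -, hb0, -, hi, h7, h8⟩ :=
      h.exists_frame p q r s u v w z h1 (h2.symm ▸ one_ne_zero)
    refine ⟨e', i', hF, fun x => by rw [delCubic_op, delCubic_op, h7], fun x => ?_⟩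
    simp only [rank, h0, hD, if_false, if_true, normalForm, Matrix.cons_val_one,
      Matrix.cons_val_zero, barCubic, cubicOne, Cubic.op, List.map_cons, List.map_nil,
      List.sum_cons, List.sum_nil, add_zero, LinearMap.add_apply, LinearMap.smul_apply,
      LinearMap.comp_apply, h8]
    simp only [delbarOp, he0, hb0, hi, LinearMap.add_apply, LinearMap.smul_apply, map_add,
      map_smul]
    rw [← h3, ← h4, ← neg_eq_iff_eq_neg.2 h5, ← neg_eq_iff_eq_neg.2 h6]
    push_cast
    module
  · have h1 : t 0 0 * t 1 1 - t 0 1 * t 1 0 ≠ 0 := by rwa [mul_comm (t 0 1)]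
    obtain ⟨e', i', hF, he0, he1, hb0, hb1, hi, h7, h8⟩ :=
      h.exists_frame 1 0 0 1 (t 0 0) (t 0 1) (t 1 0) (t 1 1) (by ring) h1
    refine ⟨e', i', hF, fun x => by rw [delCubic_op, delCubic_op, h7], fun x => ?_⟩
    simp only [rank, h0, hD, if_false, normalForm, Matrix.cons_val, barCubic, cubicTwo, Cubic.op,
      List.map_cons, List.map_nil, List.sum_cons, List.sum_nil, add_zero, LinearMap.add_apply,
      LinearMap.smul_apply, LinearMap.comp_apply, h8]
    simp only [delbarOp, he0, he1, hb0, hb1, hi, LinearMap.add_apply, LinearMap.smul_apply, map_add,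
      map_smul]
    push_cast
    module

theorem isRealization_invComplex {e i : Mode → Forms →ₗ[ℂ] Forms} {t : Param} {T : Cubic}
    (h1 : ∀ x, delCubic.op e i x = delCubic.op stdE stdI x)
    (h2 : ∀ x, T.op e i x = delbarOp stdE stdI t x) :
    IsRealization (invComplex t) invForms (delCubic.op e i) (T.op e i)
      fun p q => (invForms p q).subtype where
  injective _ _ := Subtype.val_injective
  range_eq _ _ := Submodule.range_subtype _
  d1 _ _ x := ((del_invariant x.2).trans (delCubic_op _ _ _).symm).trans (h1 _).symm
  d2 _ _ x := (delbarPhi_invariant t x.2).trans (h2 _).symm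

theorem exists_isRealization (t : Param) : ∃ e i : Mode → Forms →ₗ[ℂ] Forms,
    IsFock e i vac invForms ∧ IsRealization (invComplex t) invForms (delCubic.op e i)
      ((barCubic (normalForm (rank t))).op e i) fun p q => (invForms p q).subtype := by
  obtain ⟨e, i, hF, h1, h2⟩ := exists_adapted_frame invForms_isFock t
  exact ⟨e, i, hF, isRealization_invComplex h1 h2⟩

/-- In normal form the structure constants are integers, so `(∂ + ∂̄_{φ(t)})² = 0` is a finite check
on monomials for each of the three ranks. -/
theorem act_act (k : Fin 3) : ∀ n : Fin 64,
    Vec.Equiv (delCubic.act (delCubic.act [(1, n)])) [] ∧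
    Vec.Equiv ((barCubic (normalForm k)).act ((barCubic (normalForm k)).act [(1, n)])) [] ∧
    Vec.Equiv (delCubic.act ((barCubic (normalForm k)).act [(1, n)]) ++
      (barCubic (normalForm k)).act (delCubic.act [(1, n)])) [] := by
  revert k
  decide +kernel

theorem invComplex_isDoubleComplex (t : Param) : (invComplex t).IsDoubleComplex := by
  obtain ⟨e, i, hF, hK⟩ := exists_isRealization t
  exact hK.isDoubleComplex hF (act_act _)

theorem exists_isDecomposition (k : Fin 3) : ∃ G H,
    IsDecomposition delCubic (barCubic (normalForm k)) (diagram k) G H := by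
  fin_cases k
  exacts [⟨_, _, isDecomposition_zero⟩, ⟨_, _, isDecomposition_one⟩, ⟨_, _, isDecomposition_two⟩]

theorem invComplex_decomposesAs (t : Param) : DecomposesAs (invComplex t) (diagram (rank t)) := by
  obtain ⟨e, i, hF, hK⟩ := exists_isRealization t
  obtain ⟨G, H, hD⟩ := exists_isDecomposition (rank t)
  exact ⟨isSquare_or_isZigzag_diagram _, hD.isomorphic hF hK⟩

/-! ### The rank as a complete isomorphism invariant -/

theorem invComplex_rankZero_iff (t : Param) : (invComplex t).RankZero ↔ rank t = 0 := by
  obtain ⟨e, i, hF, hK⟩ := exists_isRealization t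
  generalize rank t = k at hK
  fin_cases k
  · exact iff_of_true (hK.rankZero hF (by decide +kernel)) rfl
  -- Here `φ² ∧ φ³` (number 6) is mapped to `φ¹ ∧ φ² ∧ φ̄¹` (number 11), in the adapted frame.
  · exact iff_of_false (hK.not_rankZero hF 6 11 (by decide +kernel) 1 one_ne_zero
      (by decide +kernel)) (by decide)
  · exact iff_of_false (hK.not_rankZero hF 6 19 (by decide +kernel) 1 one_ne_zero
      (by decide +kernel)) (by decide)

theorem invComplex_rankLeOne_iff (t : Param) : (invComplex t).RankLeOne ↔ rank t ≠ 2 := by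
  obtain ⟨e, i, hF, hK⟩ := exists_isRealization t
  generalize rank t = k at hK
  fin_cases k
  · refine iff_of_true ⟨0, fun x => ⟨0, ?_⟩⟩ (by decide)
    rw [hK.rankZero hF (by decide +kernel) x, zero_smul]
  · exact iff_of_true (hK.rankLeOne hF 11 (by decide +kernel) (by decide +kernel)) (by decide)
  -- In rank two, `φ¹ ∧ φ³` and `φ² ∧ φ³` have the independent images `φ¹ ∧ φ² ∧ φ̄¹` and `φ¹ ∧ φ² ∧
  -- φ̄²`, in the adapted frame.
  · exact iff_of_false (hK.not_rankLeOne hF 5 11 6 19 (by decide +kernel) (by decide +kernel)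
      (by decide) 1 1 one_ne_zero one_ne_zero (by decide +kernel) (by decide +kernel)) (by simp)

/-- Whether the rank is 0 and whether it is 2 are both invariant under isomorphism, and together
they determine it. Conversely, equal ranks give the same diagram. -/
theorem isomorphic_iff (s t : Param) :
    (invComplex s).Isomorphic (invComplex t) ↔ rank s = rank t := by
  constructor
  · intro h
    have h0 := (invComplex_rankZero_iff s).symm.trans
      ((⟨h.rankZero, h.symm.rankZero⟩ : _ ↔ _).trans (invComplex_rankZero_iff t))
    have h1 := (invComplex_rankLeOne_iff s).symm.trans
      ((⟨h.rankLeOne, h.symm.rankLeOne⟩ : _ ↔ _).trans (invComplex_rankLeOne_iff t))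
    generalize rank s = a at h0 h1 ⊢
    generalize rank t = b at h0 h1 ⊢
    revert a b
    decide
  · intro h
    have h1 := (invComplex_decomposesAs s).2
    rw [h] at h1
    exact h1.trans (invComplex_decomposesAs t).2.symm

theorem rank_eq_zero_iff (t : Param) : rank t = 0 ↔ (t 0 0, t 0 1, t 1 0, t 1 1) = 0 := by
  unfold rank
  split_ifs <;> simp_all

theorem rank_eq_one_iff (t : Param) :
    rank t = 1 ↔ (t 0 0, t 0 1, t 1 0, t 1 1) ≠ 0 ∧ D t = 0 := by
  unfold rank
  split_ifs <;> simp_all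

theorem rank_eq_two_iff (t : Param) : rank t = 2 ↔ D t ≠ 0 := by
  have := @D_eq_zero_of_eq_zero t
  unfold rank
  split_ifs <;> simp_all

theorem exists_rank_eq {ε : ℝ} (hε : 0 < ε) (k : Fin 3) : ∃ t ∈ B ε, rank t = k := by
  have h1 : ‖((ε / 2 : ℝ) : ℂ)‖ < ε := by
    rw [Complex.norm_real, Real.norm_of_nonneg (by positivity)]
    linarith
  have h2 : ((ε / 2 : ℝ) : ℂ) ≠ 0 := by
    exact_mod_cast (half_pos hε).ne'
  generalize ((ε / 2 : ℝ) : ℂ) = c at h1 h2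
  fin_cases k
  · refine ⟨fun _ _ => 0, fun k l => by simpa using hε, (rank_eq_zero_iff _).2 rfl⟩
  · refine ⟨fun k l => if k = 0 ∧ l = 0 then c else 0, fun k l => ?_, (rank_eq_one_iff _).2 ?_⟩
    · dsimp only
      split_ifs <;> simp [hε, h1]
    · simp [D, h2]
  · refine ⟨fun k l => if k.1 = l.1 then c else 0, fun k l => ?_, (rank_eq_two_iff _).2 ?_⟩
    · dsimp only
      split_ifs <;> simp [hε, h1]
    · simp [D, h2]

/-- Distinct diagrams need not be compared directly: diagram `k` is isomorphic to the complex of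
some parameter of rank `k`, so `isomorphic_iff` applies. -/
theorem decomposesAs_iff (t : Param) (k : Fin 3) :
    DecomposesAs (invComplex t) (diagram k) ↔ rank t = k := by
  refine ⟨fun h => ?_, fun h => h ▸ invComplex_decomposesAs t⟩
  obtain ⟨s, -, rfl⟩ := exists_rank_eq one_pos k
  exact (isomorphic_iff t s).1 (h.2.trans (invComplex_decomposesAs s).2.symm)

theorem card_quotient_isoSetoid {ε : ℝ} (hε : 0 < ε) :
    Nat.card (Quotient (isoSetoid ε)) = 3 := by
  let f : Quotient (isoSetoid ε) → Fin 3 :=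
    Quotient.lift (fun t => rank t.1) fun s t h => (isomorphic_iff s.1 t.1).1 h
  have hf : Function.Bijective f := by
    constructor
    · rintro ⟨s⟩ ⟨t⟩ h
      exact Quotient.sound ((isomorphic_iff s.1 t.1).2 h)
    · intro k
      obtain ⟨t, ht, hk⟩ := exists_rank_eq hε k
      exact ⟨Quotient.mk _ ⟨t, ht⟩, hk⟩
  rw [Nat.card_eq_of_bijective f hf, Nat.card_fin]

end Iwasawa

end

theorem theorem1p1 (ε : ℝ) (hε : 0 < ε) :
    (∀ t ∈ Iwasawa.B ε,
      (Iwasawa.invComplex t).IsDoubleComplex ∧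
      (Iwasawa.DecomposesAs (Iwasawa.invComplex t) Iwasawa.diagram1 ↔
        (t 0 0, t 0 1, t 1 0, t 1 1) = 0) ∧
      (Iwasawa.DecomposesAs (Iwasawa.invComplex t) Iwasawa.diagram2 ↔
        (t 0 0, t 0 1, t 1 0, t 1 1) ≠ 0 ∧ Iwasawa.D t = 0) ∧
      (Iwasawa.DecomposesAs (Iwasawa.invComplex t) Iwasawa.diagram3 ↔
        Iwasawa.D t ≠ 0)) ∧
    Nat.card (Quotient (Iwasawa.isoSetoid ε)) = 3 :=
  ⟨fun t _ => ⟨Iwasawa.invComplex_isDoubleComplex t,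
    (Iwasawa.decomposesAs_iff t 0).trans (Iwasawa.rank_eq_zero_iff t),
    (Iwasawa.decomposesAs_iff t 1).trans (Iwasawa.rank_eq_one_iff t),
    (Iwasawa.decomposesAs_iff t 2).trans (Iwasawa.rank_eq_two_iff t)⟩,
    Iwasawa.card_quotient_isoSetoid hε⟩
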